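/- **Setting.** A causal graph $\mathcal G$ on a finite set $\mathbf V$ of $n$ variables has directed edges $\to$ (without directed cycles) and bidirected edges $\leftrightarrow$ between distinct variables; $m$ is the total number of edges. An ordering $\mathbf V^{\prec}$ of all variables is consistent with $\mathcal G$ if $X\prec Y$ implies that $Y$ is not an ancestor of $X$; $\mathbf V^{\le X}=\{Y : Y\prec X \text{ or } Y=X\}$. $Pa(\mathbf S), An(\mathbf S), De(\mathbf S)$ are the parents, ancestors and descendants of $\mathbf S$, each including $\mathbf S$; $Sp(\mathbf S)$ is the set of nodes joined by a bidirected edge to an element of $\mathbf S$; $\mathcal G_{\mathbf S}$ is the induced subgraph; $\mathcal C(X)_{\mathcal G_{\mathbf S}}$ is the set of nodes joined to $X$ by paths of bidirected edges in $\mathcal G_{\mathbf S}$. $\mathbf C$ is an *ancestral c-component (AC) relative to $X$* if $\mathbf C=\mathcal C(X)_{\mathcal G_{\mathbf S}}$ for some $\mathbf S$ with $X\in\mathbf S\subseteq \mathbf V^{\le X}$ and $\mathbf S=An(\mathbf S)$. For each $X$ and each AC $\mathbf C$ relative to $X$, the c-component local Markov property (C-LMP) invokes the conditional independence relation (CI)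 $$X \perp\!\!\!\perp \mathbf S^+\setminus Pa(\mathbf C)\mid Pa(\mathbf C)\setminus\{X\},\qquad \mathbf S^+=\mathbf V^{\le X}\setminus De(Sp(\mathbf C)\setminus Pa(\mathbf C)).$$ The CI is *non-vacuous*, and $\mathbf C$ *admissible* (an AAC), if $\mathbf S^+\setminus Pa(\mathbf C)\ne\emptyset$. **Algorithms.** * $\textsc{ListCI}(\mathcal G,\mathbf V^\prec)$: for each $X$ in the order $\mathbf V^\prec$, call $\textsc{ListCIX}(\mathcal G_{\mathbf V^{\le X}},X,\mathbf I,\mathbf R)$ with $\mathbf I=\mathcal C(X)_{\mathcal G_{An(\{X\})}}$ and $\mathbf R=\mathcal C(X)_{\mathcal G_{\mathbf V^{\le X}}}$. * $\textsc{ListCIX}(\mathcal G_{\mathbf V^{\le X}},X,\mathbf I,\mathbf R)$: if $\textsc{FindAAC}(\mathcal G_{\mathbf V^{\le X}},X,\mathbf I,\mathbf R)=\perp$, return. If $\mathbf I=\mathbf R$, output the CI of $\mathbf C=\mathbf I$ and return. Otherwise choose any $S\in\mathbf R\cap(Sp(\mathbf I)\setminus\mathbf I)$, put $\mathbf I'=\mathcal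 C(X)_{\mathcal G_{An(\mathbf I\cup\{S\})}}$ and $\mathbf R'=\mathcal C(X)_{\mathcal G_{\mathbf R\setminus De(\{S\})}}$, and call $\textsc{ListCIX}$ first on $(\mathbf I,\mathbf R')$ and then on $(\mathbf I',\mathbf R)$. * $\textsc{FindAAC}(\mathcal G_{\mathbf V^{\le X}},X,\mathbf I,\mathbf R)$: if $\mathbf S^+\setminus Pa(\mathbf I)\neq\emptyset$ for $\mathbf C=\mathbf I$, return $\mathbf I$. Otherwise, for each $D\in De(Sp(\mathbf I)\setminus Pa(\mathbf I))$, let $\mathbf Z = An(\{X,D\}\cup Pa(\mathbf I))\cap (Pa(\mathbf R)\setminus\{X,D\})$ and test in $\mathcal G_{\mathbf V^{\le X}}$ by graph search whether $\mathbf Z$ d-separates $X$ from $D$; if so, return $\mathcal C(X)_{\mathcal G_{An(\mathbf I\cup\mathbf Z)}}$. If no $D$ succeeds, return $\perp$. The algorithms run on a unit-cost random access machine, with graphs given by adjacency lists (in any order) and sets of nodes stored as bit arrays. *Delay at most $d$* means that at most $d$ steps are spent before the first output, between consecutive outputs, and after the last output until termination. **Theorem (Correctness of ListCI).** There is an absolute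 constant $c$ such that the following holds for every causal graph $\mathcal G$ with $n$ nodes and $m$ edges, every ordering $\mathbf V^\prec$ consistent with $\mathcal G$, and every rule for choosing $S$. 1. $\textsc{ListCI}(\mathcal G,\mathbf V^\prec)$ lists all non-vacuous CIs invoked by C-LMP for $\mathcal G$ with respect to $\mathbf V^\prec$, and only those, each exactly once, with delay at most $c\,n^2(n+m)$. 2. (Supporting lemmas.) Let $X\in\mathbf V$ and let $\mathbf I\subseteq\mathbf R$ be ACs relative to $X$. Then $\textsc{FindAAC}(\mathcal G_{\mathbf V^{\le X}},X,\mathbf I,\mathbf R)$ returns an AAC $\mathbf C$ relative to $X$ with $\mathbf I\subseteq\mathbf C\subseteq\mathbf R$ if there is one, and $\perp$ otherwise; and $\textsc{ListCIX}(\mathcal G_{\mathbf V^{\le X}},X,\mathbf I,\mathbf R)$ lists the CIs of all AACs $\mathbf C$ relative to $X$ with $\mathbf I\subseteq\mathbf C\subseteq\mathbf R$, and only those, each exactly once, with delay at most $c\,n^2(n+m)$. -/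

import Mathlib

/-! ## Causal graphs -/

/-- A (semi-Markovian) causal graph on the variables `V`: an acyclic set of directed edges
(`dir u v` is `u → v`) and a set of bidirected edges (`bi.Adj u v` is `u ↔ v`). -/
structure CausalGraph (V : Type) where
  dir : V → V → Prop
  acyclic : ∀ v, ¬ Relation.TransGen dir v v
  bi : SimpleGraph V

namespace CausalGraph

/-- Parents of a set, including the set itself. -/
def Pa {V : Type} (G : CausalGraph V) (S : Set V) : Set V :=
  S ∪ {u | ∃ v ∈ S, G.dir u v}

/-- Ancestors of a set, including the set itself. -/
def An {V : Type} (G : CausalGraph V) (S : Set V) : Set V :=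
  {u | ∃ v ∈ S, Relation.ReflTransGen G.dir u v}

/-- Descendants of a set, including the set itself. -/
def De {V : Type} (G : CausalGraph V) (S : Set V) : Set V :=
  {u | ∃ v ∈ S, Relation.ReflTransGen G.dir v u}

/-- Spouses of a set: the bidirected neighbours of its elements. -/
def Spo {V : Type} (G : CausalGraph V) (S : Set V) : Set V :=
  {u | ∃ v ∈ S, G.bi.Adj u v}

/-- A set is ancestral if it equals its set of ancestors. -/
def IsAncestral {V : Type} (G : CausalGraph V) (S : Set V) : Prop := G.An S = S

/-- The c-component `C(X)_{G_S}` of `X` in the subgraph of `G` induced on `S` (used for `X ∈ S`):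
all nodes joined to `X` by a path of bidirected edges that runs inside `S`. -/
def cComponent {V : Type} (G : CausalGraph V) (S : Set V) (X : V) : Set V :=
  {Y | Relation.ReflTransGen (fun a b => a ∈ S ∧ b ∈ S ∧ G.bi.Adj a b) X Y}

/-- The number of edges, directed and bidirected. -/
noncomputable def numEdges {V : Type} (G : CausalGraph V) : ℕ :=
  {e : V × V | G.dir e.1 e.2}.ncard + G.bi.edgeSet.ncard

/-- The list `ord` is an ordering of all the variables (each occurring once) consistent with `G`:
if `X` comes before `Y`, then `Y` is not an ancestor of `X`. -/
def IsConsistentOrder {V : Type} [DecidableEq V] (G : CausalGraph V) (ord : List V) : Prop :=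
  ord.Nodup ∧ (∀ v, v ∈ ord) ∧ ∀ X Y, ord.idxOf X < ord.idxOf Y → Y ∉ G.An {X}

end CausalGraph

/-- `V^{≤ X}`: the variables up to and including `X` in the ordering. -/
def upTo {V : Type} [DecidableEq V] (ord : List V) (X : V) : Set V :=
  {Y | ord.idxOf Y ≤ ord.idxOf X}

/-! ## The c-component local Markov property -/

/-- A formal conditional independence relation `lhs ⊥ indep | cond`. -/
@[ext]
structure CIRel (V : Type) where
  lhs : V
  indep : Set V
  cond : Set V

namespace CausalGraph

/-- `AC_X`: the ancestral c-components relative to `X`. -/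
def AC {V : Type} [DecidableEq V] (G : CausalGraph V) (ord : List V) (X : V) : Set (Set V) :=
  {C | ∃ S : Set V, G.IsAncestral S ∧ S ⊆ upTo ord X ∧ X ∈ S ∧ G.cComponent S X = C}

/-- `S⁺ = V^{≤ X} \ De(Spo(C) \ Pa(C))`. -/
def SPlus {V : Type} [DecidableEq V] (G : CausalGraph V) (ord : List V) (X : V) (C : Set V) :
    Set V :=
  upTo ord X \ G.De (G.Spo C \ G.Pa C)

/-- The relation `X ⊥ S⁺ \ Pa(C) | Pa(C) \ {X}` that the c-component local Markov property invokes
for the variable `X` and the ancestral c-component `C`. -/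
def ciOf {V : Type} [DecidableEq V] (G : CausalGraph V) (ord : List V) (X : V) (C : Set V) :
    CIRel V :=
  ⟨X, G.SPlus ord X C \ G.Pa C, G.Pa C \ {X}⟩

/-- The conditional independence relations invoked by the c-component local Markov property. -/
def invokedCIs {V : Type} [DecidableEq V] (G : CausalGraph V) (ord : List V) : Set (CIRel V) :=
  {r | ∃ X : V, ∃ C ∈ G.AC ord X, r = G.ciOf ord X C}

/-- The admissible ancestral c-components relative to `X`: those whose relation is
non-vacuous. -/
def AAC {V : Type} [DecidableEq V] (G : CausalGraph V) (ord : List V) (X : V) : Set (Set V) :=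
  {C | C ∈ G.AC ord X ∧ (G.ciOf ord X C).indep ≠ ∅}

/-- The non-vacuous relations invoked by the c-component local Markov property. -/
def nonvacuousCIs {V : Type} [DecidableEq V] (G : CausalGraph V) (ord : List V) :
    Set (CIRel V) :=
  {r | r ∈ G.invokedCIs ord ∧ r.indep ≠ ∅}

end CausalGraph

/-! ## The machine model

Programs run on a unit-cost random access machine; the memory holds nodes, lists of nodes and
arrays indexed by nodes. A program is a value together with the trace of what it did: one `step`
for each elementary operation (up to a fixed constant factor), and one `output` for each item that
it outputs. Iterating over a list costs at least one step per element. An array `V → Bool` is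
allocated in `|V|` steps and then accessed only by reads and writes that cost one step each. Once an
entry has been overwritten, no program uses the older version of the array, so that every write can
be carried out in place. -/

inductive TraceEvent (O : Type) where
  | step
  | output (o : O)

structure Comp (O α : Type) where
  trace : List (TraceEvent O)
  val : α

instance instMonadComp (O : Type) : Monad (Comp O) where
  pure a := ⟨[], a⟩
  bind x f := ⟨x.trace ++ (f x.val).trace, (f x.val).val⟩

namespace Comp

/-- Spend `k` elementary steps. -/
def charge {O : Type} (k : ℕ) : Comp O Unit := ⟨List.replicate k TraceEvent.step, ()⟩

def emit {O : Type} (o : O) : Comp O Unit := ⟨[TraceEvent.output o], ()⟩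

/-- The items output, in the order of output. -/
def outputs {O α : Type} (c : Comp O α) : List O :=
  c.trace.filterMap fun e => match e with
    | TraceEvent.step => none
    | TraceEvent.output o => some o

/-- The delay is at most `d`: every stretch of the run without an output has at most `d` steps.
This covers the time up to the first output, the time between consecutive outputs, and the time
from the last output to termination. -/
def DelayAtMost {O α : Type} (c : Comp O α) (d : ℕ) : Prop :=
  ∀ l : List (TraceEvent O), l <:+: c.trace → (∀ e ∈ l, e = TraceEvent.step) → l.length ≤ d

end Comp

open Comp in
/-- Allocate an array with all entries `false`. -/
def newArray {O : Type} (α : Type) [Fintype α] : Comp O (α → Bool) := do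
  charge (Fintype.card α)
  return fun _ => false

open Comp in
def getBit {O α : Type} (a : α → Bool) (v : α) : Comp O Bool := do
  charge 1
  return a v

open Comp in
def setBit {O α : Type} [DecidableEq α] (a : α → Bool) (v : α) : Comp O (α → Bool) := do
  charge 1
  return Function.update a v true

/-- Write `true` at all entries from a list. -/
def setBits {O α : Type} [DecidableEq α] (a : α → Bool) (l : List α) : Comp O (α → Bool) :=
  l.foldlM setBit a

open Comp in
/-- The elements of a list that pass a test, in the same order. -/
def filterList {O α : Type} (p : α → Comp O Bool) : List α → Comp O (List α)
  | [] => do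
    charge 1
    return []
  | v :: l => do
    charge 1
    let r ← filterList p l
    if ← p v then
      return v :: r
    else
      return r

/-- The elements of a list that pass a test, as an array. -/
def selectArray {O α : Type} [Fintype α] [DecidableEq α] (p : α → Comp O Bool) (l : List α) :
    Comp O (α → Bool) := do
  let r ← filterList p l
  setBits (← newArray α) r

open Comp in
/-- Mark all unmarked elements of a list and push them on the stack. -/
def pushAll {O α : Type} [DecidableEq α] (vis : α → Bool) (stk : List α) (l : List α) :
    Comp O ((α → Bool) × List α) :=
  l.foldlM (fun s w => do
    if ← getBit s.1 w then
      return s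
    else
      let vis' ← setBit s.1 w
      charge 1
      return (vis', w :: s.2)) (vis, stk)

open Comp in
/-- At most `k` rounds of: pop a node, mark and push its unmarked successors. -/
def reachLoop {O α : Type} [DecidableEq α] (succ : α → Comp O (List α)) :
    ℕ → (α → Bool) → List α → Comp O (α → Bool)
  | 0, vis, _ => return vis
  | _ + 1, vis, [] => return vis
  | k + 1, vis, v :: stk => do
    charge 1
    let nb ← succ v
    let s ← pushAll vis stk nb
    reachLoop succ k s.1 s.2

/-- Graph search: the array of all nodes reachable from the list `src`. A node is pushed at most
once, so that as many rounds as there are nodes are enough. -/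
def reach {O α : Type} [Fintype α] [DecidableEq α] (succ : α → Comp O (List α)) (src : List α) :
    Comp O (α → Bool) := do
  let s ← pushAll (← newArray α) [] src
  reachLoop succ (Fintype.card α) s.1 s.2

/-! ## Graphs as data -/

/-- A graph as the machine stores it: its list of nodes, and for each node the lists of its
parents, its children and its spouses (here a node is not listed as its own parent). -/
structure AdjLists (V : Type) where
  verts : List V
  pa : V → List V
  ch : V → List V
  sp : V → List V

/-- `A` stores the subgraph of `G` induced on `S`. The lists have no repetitions, and they may be
in any order. -/
structure AdjLists.Stores {V : Type} (A : AdjLists V) (G : CausalGraph V) (S : Set V) : Prop where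
  verts_nodup : A.verts.Nodup
  mem_verts : ∀ v, v ∈ A.verts ↔ v ∈ S
  pa_nodup : ∀ v, (A.pa v).Nodup
  mem_pa : ∀ u v, u ∈ A.pa v ↔ u ∈ S ∧ v ∈ S ∧ G.dir u v
  ch_nodup : ∀ v, (A.ch v).Nodup
  mem_ch : ∀ u v, u ∈ A.ch v ↔ u ∈ S ∧ v ∈ S ∧ G.dir v u
  sp_nodup : ∀ v, (A.sp v).Nodup
  mem_sp : ∀ u v, u ∈ A.sp v ↔ u ∈ S ∧ v ∈ S ∧ G.bi.Adj u v

/-- A conditional independence relation as the machine outputs it: `lhs ⊥ indep | cond`, with the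
two sets written as lists. -/
structure CIOutput (V : Type) where
  lhs : V
  indep : List V
  cond : List V

/-- The relation that an output denotes. -/
def CIOutput.toRel {V : Type} (o : CIOutput V) : CIRel V :=
  ⟨o.lhs, {v | v ∈ o.indep}, {v | v ∈ o.cond}⟩

/-- Programs that output conditional independence relations on `V`. -/
abbrev Prog (V α : Type) : Type := Comp (CIOutput V) α

namespace AdjLists

open Comp in
/-- Restrict a table of adjacency lists to the nodes in `S`. -/
def restrictTable {V : Type} [Fintype V] [DecidableEq V] (verts : List V) (t : V → List V)
    (S : V → Bool) : Prog V (V → List V) := do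
  charge (Fintype.card V)
  verts.foldlM (fun t' v => do
    if ← getBit S v then
      let l ← filterList (getBit S) (t v)
      charge 1
      return Function.update t' v l
    else
      return t') (fun _ => [])

/-- The induced subgraph `G_S`. -/
def induce {V : Type} [Fintype V] [DecidableEq V] (A : AdjLists V) (S : V → Bool) :
    Prog V (AdjLists V) := do
  let verts ← filterList (getBit S) A.verts
  let pa ← restrictTable A.verts A.pa S
  let ch ← restrictTable A.verts A.ch S
  let sp ← restrictTable A.verts A.sp S
  return ⟨verts, pa, ch, sp⟩

/-- `Pa(S)`, including `S`. -/
def paSet {V : Type} [Fintype V] [DecidableEq V] (A : AdjLists V) (S : V → Bool) :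
    Prog V (V → Bool) := do
  let a ← newArray V
  A.verts.foldlM (fun a v => do
    if ← getBit S v then
      setBits a (v :: A.pa v)
    else
      return a) a

/-- `Spo(S)`. -/
def spSet {V : Type} [Fintype V] [DecidableEq V] (A : AdjLists V) (S : V → Bool) :
    Prog V (V → Bool) := do
  let a ← newArray V
  A.verts.foldlM (fun a v => do
    if ← getBit S v then
      setBits a (A.sp v)
    else
      return a) a

open Comp in
/-- `An(S)`. -/
def anSet {V : Type} [Fintype V] [DecidableEq V] (A : AdjLists V) (S : V → Bool) :
    Prog V (V → Bool) := do
  let src ← filterList (getBit S) A.verts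
  reach (fun v => do charge 1; return A.pa v) src

open Comp in
/-- `De(S)`. -/
def deSet {V : Type} [Fintype V] [DecidableEq V] (A : AdjLists V) (S : V → Bool) :
    Prog V (V → Bool) := do
  let src ← filterList (getBit S) A.verts
  reach (fun v => do charge 1; return A.ch v) src

open Comp in
/-- The c-component `C(X)` of the stored graph. -/
def cComp {V : Type} [Fintype V] [DecidableEq V] (A : AdjLists V) (X : V) :
    Prog V (V → Bool) :=
  reach (fun v => do charge 1; return A.sp v) [X]

/-- `S \ T`. -/
def diffSet {V : Type} [Fintype V] [DecidableEq V] (A : AdjLists V) (S T : V → Bool) :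
    Prog V (V → Bool) :=
  selectArray (fun v => do return (← getBit S v) && !(← getBit T v)) A.verts

/-- `S ∪ T`. -/
def unionSet {V : Type} [Fintype V] [DecidableEq V] (A : AdjLists V) (S T : V → Bool) :
    Prog V (V → Bool) :=
  selectArray (fun v => do return (← getBit S v) || (← getBit T v)) A.verts

/-- Test whether `S = T`. -/
def eqSet {V : Type} (A : AdjLists V) (S T : V → Bool) : Prog V Bool := do
  let r ← filterList (fun v => do return (← getBit S v) != (← getBit T v)) A.verts
  return r.isEmpty

/-! ## The algorithms

In the following procedures `A` stores the subgraph `G_{V^{≤ X}}`, so that `A.verts` lists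
`V^{≤ X}`, unless said otherwise. -/

open Comp in
/-- The moves of the search for active walks, given `Z` and `anZ = An(Z)`. The state `(v, true)`
(`(v, false)`) says that `v` was entered by an edge with an arrowhead (a tail) at `v`. A walk may
pass `v` as a collider if `v ∈ An(Z)`, and as a non-collider if `v ∉ Z`. -/
def activeMoves {V : Type} (A : AdjLists V) (Z anZ : V → Bool) (s : V × Bool) :
    Prog V (List (V × Bool)) := do
  let inZ ← getBit Z s.1
  let inAnZ ← getBit anZ s.1
  let up := (A.pa s.1).map (fun u => (u, false)) ++ (A.sp s.1).map (fun u => (u, true))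
  let down := (A.ch s.1).map (fun u => (u, true))
  charge (1 + up.length + down.length)
  return match s.2 with
    | false => if inZ then [] else up ++ down
    | true => (if inAnZ then up else []) ++ (if inZ then [] else down)

/-- Test whether `Z` d-separates `X` from `D`, where `X` and `D` are not in `Z`. -/
def testSep {V : Type} [Fintype V] [DecidableEq V] (A : AdjLists V) (X D : V) (Z : V → Bool) :
    Prog V Bool := do
  let anZ ← A.anSet Z
  let vis ← reach (A.activeMoves Z anZ) [(X, false)]
  return !((← getBit vis (D, false)) || (← getBit vis (D, true)))

open Comp in
/-- FindSeparator: a set `Z` that d-separates `X` from `D` with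
`P \ {X, D} ⊆ Z ⊆ Q \ {X, D}`, or `none`. The only candidate to be tested is
`Z = An({X, D} ∪ P) ∩ (Q \ {X, D})`. -/
def findSeparator {V : Type} [Fintype V] [DecidableEq V] (A : AdjLists V) (X D : V)
    (P Q : V → Bool) : Prog V (Option (V → Bool)) := do
  let XD ← setBits (← newArray V) [X, D]
  let S ← A.unionSet XD P
  let N ← A.anSet S
  let QN ← selectArray (fun v => do return (← getBit Q v) && (← getBit N v)) A.verts
  let Z ← A.diffSet QN XD
  if ← A.testSep X D Z then
    return some Z
  else
    return none

/-- `De(Spo(C) \ Pa(C))`. -/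
def blockedSet {V : Type} [Fintype V] [DecidableEq V] (A : AdjLists V) (C : V → Bool) :
    Prog V (V → Bool) := do
  A.deSet (← A.diffSet (← A.spSet C) (← A.paSet C))

/-- The list of `S⁺ \ Pa(C)`, where `S⁺ = V^{≤ X} \ De(Spo(C) \ Pa(C))`. -/
def indepSide {V : Type} [Fintype V] [DecidableEq V] (A : AdjLists V) (C : V → Bool) :
    Prog V (List V) := do
  let B ← A.blockedSet C
  let P ← A.paSet C
  filterList (fun v => do return !(← getBit B v) && !(← getBit P v)) A.verts

/-- IsAdmissible. -/
def isAdmissible {V : Type} [Fintype V] [DecidableEq V] (A : AdjLists V) (C : V → Bool) :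
    Prog V Bool := do
  let W ← A.indepSide C
  return !W.isEmpty

open Comp in
/-- The loop of FindAAC over a list of candidates `D`; `P = Pa(I)` and `Q = Pa(R)`. -/
def findAACLoop {V : Type} [Fintype V] [DecidableEq V] (A : AdjLists V) (X : V)
    (I P Q : V → Bool) : List V → Prog V (Option (V → Bool))
  | [] => do
    charge 1
    return none
  | D :: Ds => do
    charge 1
    match ← A.findSeparator X D P Q with
    | some Z =>
      let N ← A.anSet (← A.unionSet I Z)
      return some (← (← A.induce N).cComp X)
    | none => A.findAACLoop X I P Q Ds

/-- FindAAC: an admissible ancestral c-component `C` relative to `X` with `I ⊆ C ⊆ R`,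
or `none`. -/
def findAAC {V : Type} [Fintype V] [DecidableEq V] (A : AdjLists V) (X : V) (I R : V → Bool) :
    Prog V (Option (V → Bool)) := do
  if ← A.isAdmissible I then
    return some I
  else
    let B ← A.blockedSet I
    let P ← A.paSet I
    let Q ← A.paSet R
    let Ds ← filterList (getBit B) A.verts
    A.findAACLoop X I P Q Ds

open Comp in
/-- Output `X ⊥ S⁺ \ Pa(C) | Pa(C) \ {X}`. -/
def outputCI {V : Type} [Fintype V] [DecidableEq V] (A : AdjLists V) (X : V) (C : V → Bool) :
    Prog V Unit := do
  let W ← A.indepSide C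
  let P ← A.paSet C
  let Z ← filterList (fun v => do return (← getBit P v) && v != X) A.verts
  charge (1 + W.length + Z.length)
  emit ⟨X, W, Z⟩

open Comp in
/-- ListCIX. The rule `pick` makes the choice of "any node `S` in `T`"; it may use `X`, `I`, `R`
and the list of `T`. The first numerical argument is a cap on the depth of the recursion. -/
def listCIX {V : Type} [Fintype V] [DecidableEq V]
    (pick : V → (V → Bool) → (V → Bool) → List V → V) (A : AdjLists V) (X : V) :
    ℕ → (V → Bool) → (V → Bool) → Prog V Unit
  | 0, _, _ => return ()
  | k + 1, I, R => do
    charge 1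
    match ← A.findAAC X I R with
    | none => return ()
    | some _ =>
      if ← A.eqSet I R then
        A.outputCI X I
      else
        let spI ← A.spSet I
        let T ← filterList
          (fun v => do return (← getBit R v) && (← getBit spI v) && !(← getBit I v)) A.verts
        charge (1 + T.length)
        match T with
        | [] => return ()
        | t :: ts =>
          let S := pick X I R (t :: ts)
          let one ← setBits (← newArray V) [S]
          let N ← A.anSet (← A.unionSet I one)
          let I' ← (← A.induce N).cComp X
          let M ← A.diffSet R (← A.deSet one)
          let R' ← (← A.induce M).cComp X
          listCIX pick A X k I R'
          listCIX pick A X k I' R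
          charge 1

/-- ListCI. Here `A` stores the whole graph `G`, and `U` is the array of the nodes up to the current
variable `X`. -/
def listCI {V : Type} [Fintype V] [DecidableEq V]
    (pick : V → (V → Bool) → (V → Bool) → List V → V) (depth : ℕ) (A : AdjLists V)
    (ord : List V) : Prog V Unit := do
  let U₀ ← newArray V
  let _ ← ord.foldlM (fun U X => do
    let U' ← setBit U X
    let N ← A.anSet (← setBits (← newArray V) [X])
    let I ← (← A.induce N).cComp X
    let AX ← A.induce U'
    let R ← AX.cComp X
    AX.listCIX pick X depth I R
    return U') U₀
  return ()

end AdjLists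

/-- The program `c` lists all the relations in `L` and only those, each exactly once, with delay at
most `d`. -/
def EnumeratesExactly {V α : Type} (c : Prog V α) (L : Set (CIRel V)) (d : ℕ) : Prop :=
  (∀ r, r ∈ c.outputs.map CIOutput.toRel ↔ r ∈ L) ∧
  (c.outputs.map CIOutput.toRel).Nodup ∧
  c.DelayAtMost d

/-! Fix `X` and work inside `S = V^{≤X}`, an ancestral set in which `X` has no children. The
relations for `X` come from the ancestral c-components (ACs) between the least one, taken in
`An({X})`, and the greatest one, taken in `S`. ListCIX searches such an interval from `I` to `R` by
binary splitting at a spouse `s ∈ R` of `I` outside `I`. An AC `C` of the interval that contains `s`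
contains the component of `An(I ∪ {s})` (`IsAC.extend_subset`). If `s ∉ C`, then `C` misses every
descendant of `s`: the ancestral set behind `C` would otherwise contain `s`, and a spouse in that
set is absorbed into `C` (`IsAC.disjoint_De`). So `C` lies in the component of `R \ De({s})`. The
two halves are disjoint, because `s` belongs to the new lower end and not to the new upper end.
Distinct ACs have distinct relations, because `C` is the component of `X` in `Pa(C)`
(`IsAC.eq_of_Pa_diff_eq`).

FindAAC rests on an equivalence between separators and admissible ACs. If `Z` separates `X` from a
candidate `D`, then the component `C` of `An(I ∪ Z)` is admissible with `D` on its independent side: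
all of `C` is reached from `X` through open colliders, so a forbidden position of `D` would open a
walk (`Separates.exists_indep`). Conversely, if an admissible `C` has `D` on its independent side,
the one set tested for `D` separates: active walks satisfy an invariant that never holds at `D`
(`IsAC.separates`).

For the delay, every call that passes FindAAC outputs something, so silent calls are failing calls
and cost one local bound `F`. Since `R \ I` loses at least `s` at each level, the depth is at most
the number of nodes, and the silent prefixes and suffixes grow by at most `2F + 2` per level
(`trace_listCIX`). In ListCI, variables without relations are silent and cost `O(F)` each. As `F` is
of order `n(n+m)`, both contributions are of order `n²(n+m)`. -/

/-! ## Reasoning about silent programs -/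

namespace Comp

variable {O α β : Type}

/-- The program `c` outputs nothing, takes at most `k` steps, and its value satisfies `P`. -/
def Spec (c : Comp O α) (k : ℕ) (P : α → Prop) : Prop :=
  (∀ e ∈ c.trace, e = TraceEvent.step) ∧ c.trace.length ≤ k ∧ P c.val

theorem trace_bind (x : Comp O α) (f : α → Comp O β) :
    (x >>= f).trace = x.trace ++ (f x.val).trace := rfl

theorem trace_pure (a : α) : (pure a : Comp O α).trace = [] := rfl

theorem spec_pure {a : α} {P : α → Prop} (h : P a) : Spec (pure a : Comp O α) 0 P :=
  ⟨by simp [trace_pure], by simp [trace_pure], h⟩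

theorem Spec.bind {x : Comp O α} {f : α → Comp O β} {a b : ℕ} {P : α → Prop} {Q : β → Prop}
    (hx : Spec x a P) (hf : ∀ v, P v → Spec (f v) b Q) : Spec (x >>= f) (a + b) Q := by
  obtain ⟨h1, h2, h3⟩ := hx
  obtain ⟨g1, g2, g3⟩ := hf _ h3
  refine ⟨fun e he => ?_, ?_, g3⟩
  · rw [trace_bind, List.mem_append] at he
    exact he.elim (h1 e) (g1 e)
  · rw [trace_bind, List.length_append]
    omega

theorem Spec.mono {c : Comp O α} {a b : ℕ} {P Q : α → Prop} (h : Spec c a P) (hab : a ≤ b)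
    (hPQ : ∀ v, P v → Q v) : Spec c b Q :=
  ⟨h.1, h.2.1.trans hab, hPQ _ h.2.2⟩

theorem Spec.le {c : Comp O α} {a b : ℕ} {P : α → Prop} (h : Spec c a P) (hab : a ≤ b) :
    Spec c b P := h.mono hab fun _ => id

theorem Spec.val {c : Comp O α} {a : ℕ} {P : α → Prop} (h : Spec c a P) : P c.val := h.2.2

theorem spec_charge (k : ℕ) : Spec (charge k : Comp O Unit) k (fun _ => True) :=
  ⟨by simp [charge, List.mem_replicate], by simp [charge], trivial⟩

/-- The invariant depends on the part of the list already processed, and the cost on the current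
element alone. Thus a loop over nodes that reads adjacency lists is charged a sum of degrees instead
of length times maximum. -/
theorem spec_foldlM {f : β → α → Comp O β} {l : List α} {cost : α → ℕ}
    (Inv : List α → β → Prop)
    (hf : ∀ b, ∀ pre v, pre ++ [v] <+: l → Inv pre b → Spec (f b v) (cost v) (Inv (pre ++ [v])))
    {b : β} (hb : Inv [] b) : Spec (l.foldlM f b) ((l.map cost).sum) (Inv l) := by
  suffices H : ∀ (suf pre : List α) (b : β), pre ++ suf = l → Inv pre b →
      Spec (suf.foldlM f b) ((suf.map cost).sum) (Inv l) from H l [] b rfl hb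
  intro suf
  induction suf with
  | nil =>
    intro pre b hl hb
    rw [List.append_nil] at hl
    subst hl
    exact spec_pure hb
  | cons v suf ih =>
    intro pre b hl hb
    rw [List.foldlM_cons, List.map_cons, List.sum_cons]
    refine (hf b pre v ⟨suf, by simpa using hl⟩ hb).bind fun b' hb' => ?_
    exact ih _ _ (by simpa using hl) hb'

end Comp

open Comp

/-! ### Cost and meaning of the array primitives and of graph search. -/

section ArrayPrograms

variable {O α : Type}

theorem spec_newArray [Fintype α] :
    Spec (newArray α : Comp O (α → Bool)) (Fintype.card α) (fun r => ∀ v, r v = false) :=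
  (spec_charge _).bind (b := 0) fun _ _ => spec_pure fun _ => rfl

theorem spec_getBit (a : α → Bool) (v : α) :
    Spec (getBit a v : Comp O Bool) 1 (fun r => r = a v) :=
  (spec_charge _).bind (b := 0) fun _ _ => spec_pure rfl

theorem spec_setBit [DecidableEq α] (a : α → Bool) (v : α) :
    Spec (setBit a v : Comp O (α → Bool)) 1 (fun r => r = Function.update a v true) :=
  (spec_charge _).bind (b := 0) fun _ _ => spec_pure rfl

theorem update_true_iff [DecidableEq α] (a : α → Bool) (v w : α) :
    Function.update a v true w = true ↔ a w = true ∨ w = v := by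
  by_cases h : w = v
  · subst h; simp
  · simp [h]

theorem spec_setBits [DecidableEq α] (a : α → Bool) (l : List α) :
    Spec (setBits a l : Comp O (α → Bool)) l.length
      (fun r => ∀ v, r v = true ↔ a v = true ∨ v ∈ l) := by
  have h := spec_foldlM (O := O) (f := setBit) (l := l) (b := a) (cost := fun _ => 1)
    (fun pre r => ∀ v, r v = true ↔ a v = true ∨ v ∈ pre)
    (fun b pre v _ hb => (spec_setBit b v).mono le_rfl fun r hr w => by
      subst hr
      rw [update_true_iff, hb, List.mem_append, List.mem_singleton, or_assoc])
    (by simp)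
  simpa [setBits] using h

theorem spec_filterList {p : α → Comp O Bool} {q : α → Bool} {c : ℕ} (l : List α)
    (hp : ∀ v, Spec (p v) c (fun r => r = q v)) :
    Spec (filterList p l) ((c + 1) * l.length + 1) (fun r => r = l.filter q) := by
  induction l with
  | nil => exact (spec_charge 1).bind (b := 0) fun _ _ => spec_pure (by simp)
  | cons v l ih =>
    have : Spec (filterList p (v :: l)) (1 + (((c + 1) * l.length + 1) + (c + 0)))
        (fun r => r = (v :: l).filter q) := by
      rw [filterList]
      refine (spec_charge 1).bind fun _ _ => ih.bind fun r hr => (hp v).bind fun b hb => ?_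
      subst hr hb
      cases h : q v
      · exact spec_pure (by simp [h])
      · exact spec_pure (by simp [h])
    refine this.le ?_
    rw [List.length_cons]
    nlinarith

theorem spec_selectArray [Fintype α] [DecidableEq α] {p : α → Comp O Bool} {q : α → Bool} {c : ℕ}
    (l : List α) (hp : ∀ v, Spec (p v) c (fun r => r = q v)) :
    Spec (selectArray p l) ((c + 2) * l.length + 1 + Fintype.card α)
      (fun r => ∀ v, r v = true ↔ v ∈ l ∧ q v = true) := by
  have : Spec (selectArray p l) (((c + 1) * l.length + 1) + (Fintype.card α + l.length))
      (fun r => ∀ v, r v = true ↔ v ∈ l ∧ q v = true) := by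
    refine (spec_filterList l hp).bind fun r hr => ?_
    subst hr
    refine spec_newArray.bind fun a ha => (spec_setBits a _).mono (List.length_filter_le _ _) ?_
    intro r hr v
    simp [hr, ha, List.mem_filter]
  refine this.le ?_
  nlinarith

/-! ### Graph search -/

/-- The potential of a state of the graph search: the total weight of the nodes that are unmarked
or on the stack. -/
def searchPotential [Fintype α] (w : α → ℕ) (s : (α → Bool) × List α) : ℕ :=
  (∑ v, if s.1 v = true then 0 else w v) + (s.2.map w).sum

/-- Marking and pushing moves the weight of `v` from the unmarked nodes to the stack. Only popping
lowers the potential. -/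
theorem searchPotential_push [Fintype α] [DecidableEq α] (w : α → ℕ) (vis : α → Bool)
    (stk : List α) (v : α) (hv : vis v = false) :
    searchPotential w (Function.update vis v true, v :: stk) = searchPotential w (vis, stk) := by
  have h1 : ∀ u ∈ Finset.univ.erase v, (if Function.update vis v true u = true then 0 else w u) =
      if vis u = true then 0 else w u := by
    intro u hu
    rw [Function.update_of_ne (Finset.ne_of_mem_erase hu)]
  unfold searchPotential
  rw [← Finset.add_sum_erase _ _ (Finset.mem_univ v), Finset.sum_congr rfl h1,
    ← Finset.add_sum_erase _ (fun u => if vis u = true then 0 else w u) (Finset.mem_univ v)]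
  simp [hv]
  omega

/-- What holds after pushing the unmarked elements of `l`. -/
structure PushResult [Fintype α] (s : (α → Bool) × List α) (l : List α)
    (s' : (α → Bool) × List α) : Prop where
  mark : ∀ v, s'.1 v = true ↔ s.1 v = true ∨ v ∈ l
  stack : ∀ v, v ∈ s'.2 ↔ v ∈ s.2 ∨ (v ∈ l ∧ s.1 v = false)
  potential : ∀ w, searchPotential w s' = searchPotential w s

theorem spec_pushAll [Fintype α] [DecidableEq α] (vis : α → Bool) (stk l : List α) :
    Spec (pushAll vis stk l : Comp O _) (3 * l.length) (PushResult (vis, stk) l) := by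
  have h := spec_foldlM (O := O) (l := l) (b := (vis, stk)) (cost := fun _ => 3)
    (f := fun (s : (α → Bool) × List α) w => do
      if ← getBit s.1 w then
        return s
      else
        let vis' ← setBit s.1 w
        charge 1
        return (vis', w :: s.2))
    (PushResult (vis, stk))
    (fun s pre v _ hs => by
      refine ((spec_getBit s.1 v).bind (b := 2) fun b hb => ?_).le (by norm_num)
      cases hv : s.1 v
      · subst hb
        simp only [hv, Bool.false_eq_true, if_false]
        refine ((spec_setBit s.1 v).bind (b := 1) fun a ha => (spec_charge 1).bind (b := 0)
          fun _ _ => spec_pure ?_)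
        subst ha
        have hv' : ¬ s.1 v = true := by simp [hv]
        rw [hs.mark] at hv'
        refine ⟨fun u => ?_, fun u => ?_, fun w => ?_⟩
        · rw [update_true_iff, hs.mark, List.mem_append, List.mem_singleton, or_assoc]
        · have : vis v = false := by simpa using fun h => hv' (Or.inl h)
          simp only [List.mem_cons, hs.stack, List.mem_append, List.not_mem_nil, or_false]
          by_cases huv : u = v
          · subst huv; simp [this]
          · simp [huv]
        · rw [searchPotential_push w s.1 s.2 v hv]; exact hs.potential w
      · subst hb
        simp only [hv, if_true]
        refine (spec_pure ?_).le (Nat.zero_le _)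
        have hv' := (hs.mark v).1 hv
        refine ⟨fun u => ?_, fun u => ?_, hs.potential⟩
        · rw [hs.mark]
          by_cases huv : u = v
          · subst huv; simpa using hv'
          · simp [huv]
        · rw [hs.stack]
          by_cases huv : u = v
          · subst huv
            have hh : vis u = true ∨ u ∈ pre := hv'
            rcases hh with h | h <;> simp [h]
          · simp [huv])
    ⟨by simp, by simp, fun _ => rfl⟩
  have h' := h.le (b := 3 * l.length) (by simp [mul_comm])
  exact h'

/-- The invariant of the graph search from `src` along the lists `nb`. -/
structure SearchInv (nb : α → List α) (src : List α) (s : (α → Bool) × List α) : Prop where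
  source : ∀ v ∈ src, s.1 v = true
  marked : ∀ v ∈ s.2, s.1 v = true
  closed : ∀ v, s.1 v = true → v ∉ s.2 → ∀ u ∈ nb v, s.1 u = true
  reachable : ∀ v, s.1 v = true → ∃ a ∈ src, Relation.ReflTransGen (fun a b => b ∈ nb a) a v

/-- Once the stack is empty, the marked set contains the sources and is closed under `nb`, so it
contains everything reachable. -/
theorem SearchInv.mark_iff {nb : α → List α} {src : List α} {vis : α → Bool}
    (h : SearchInv nb src (vis, [])) (v : α) :
    vis v = true ↔ ∃ a ∈ src, Relation.ReflTransGen (fun a b => b ∈ nb a) a v := by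
  refine ⟨h.reachable v, ?_⟩
  rintro ⟨a, ha, hav⟩
  induction hav with
  | refl => exact h.source a ha
  | tail _ hbc ih => exact h.closed _ ih (by simp) _ hbc

/-- The potential is used with two weights. With weight one it bounds the remaining rounds, so the
cap `k` cannot cut the search short; with the cost of treating a node as weight it bounds the
remaining time. -/
theorem spec_reachLoop [Fintype α] [DecidableEq α] {succ : α → Comp O (List α)}
    {nb : α → List α} {cost : α → ℕ} (hsucc : ∀ v, Spec (succ v) (cost v) (fun r => r = nb v))
    (src : List α) (k : ℕ) (s : (α → Bool) × List α) (hk : searchPotential (fun _ => 1) s ≤ k)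
    (hs : SearchInv nb src s) :
    Spec (reachLoop succ k s.1 s.2)
      (searchPotential (fun v => 1 + (cost v + 3 * (nb v).length)) s)
      (fun r => ∀ v, r v = true ↔
        ∃ a ∈ src, Relation.ReflTransGen (fun a b => b ∈ nb a) a v) := by
  induction k generalizing s with
  | zero =>
    obtain ⟨vis, stk⟩ := s
    -- No rounds are left, so the unit potential is zero and nothing is waiting on the stack.
    have : stk = [] := by
      rw [← List.length_eq_zero_iff]
      simp [searchPotential] at hk
      simp [hk.2]
    subst this
    exact (spec_pure hs.mark_iff).le (Nat.zero_le _)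
  | succ k ih =>
    obtain ⟨vis, stk⟩ := s
    cases stk with
    | nil => exact (spec_pure hs.mark_iff).le (Nat.zero_le _)
    | cons v stk =>
      have hpop : ∀ w : α → ℕ, searchPotential w (vis, v :: stk) =
          w v + searchPotential w (vis, stk) := by
        intro w; simp [searchPotential]; omega
      rw [hpop, add_assoc, add_assoc]
      refine (spec_charge 1).bind fun _ _ => (hsucc v).bind fun l hl => ?_
      subst hl
      refine (spec_pushAll vis stk (nb v)).bind fun s' hs' => ?_
      rw [← hs'.potential]
      refine ih s' ?_ ?_
      · rw [hs'.potential]; rw [hpop] at hk; omega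
      · have hv : vis v = true := hs.marked v (by simp)
        refine ⟨fun u hu => (hs'.mark u).2 (Or.inl (hs.source u hu)), fun u hu => ?_,
          fun u hu hu' x hx => ?_, fun u hu => ?_⟩
        · rw [hs'.mark]
          rcases (hs'.stack u).1 hu with h | h
          · exact Or.inl (hs.marked u (by simp [show u ∈ stk from h]))
          · exact Or.inr h.1
        · rw [hs'.mark]
          rw [hs'.stack] at hu'
          push Not at hu'
          by_cases huv : u = v
          · subst huv; exact Or.inr hx
          · have hmark : vis u = true := by
              rcases (hs'.mark u).1 hu with h | h
              · exact h
              · simpa using hu'.2 h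
            exact Or.inl (hs.closed u hmark (by simpa [huv] using hu'.1) x hx)
        · rcases (hs'.mark u).1 hu with h | h
          · exact hs.reachable u h
          · obtain ⟨a, ha, hav⟩ := hs.reachable v hv
            exact ⟨a, ha, hav.tail h⟩

theorem spec_reach [Fintype α] [DecidableEq α] {succ : α → Comp O (List α)}
    {nb : α → List α} {cost : α → ℕ} (hsucc : ∀ v, Spec (succ v) (cost v) (fun r => r = nb v))
    (src : List α) :
    Spec (reach succ src)
      (Fintype.card α + (3 * src.length + ∑ v, (1 + (cost v + 3 * (nb v).length))))
      (fun r => ∀ v, r v = true ↔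
        ∃ a ∈ src, Relation.ReflTransGen (fun a b => b ∈ nb a) a v) := by
  refine spec_newArray.bind fun a ha => (spec_pushAll a [] src).bind fun s hs => ?_
  have hpot : ∀ w : α → ℕ, searchPotential w s = ∑ v, w v := by
    intro w
    rw [hs.potential]
    simp [searchPotential, ha]
  rw [← hpot]
  refine spec_reachLoop hsucc src _ s (by rw [hpot]; simp) ⟨?_, ?_, ?_, ?_⟩
  · intro v hv; exact (hs.mark v).2 (Or.inr hv)
  · intro v hv
    have := (hs.stack v).1 hv
    exact (hs.mark v).2 (Or.inr (by simpa [ha] using this))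
  · intro v hv hv'
    rw [hs.mark] at hv
    rw [hs.stack] at hv'
    simp [ha] at hv hv'
    exact absurd hv hv'
  · intro v hv
    have := (hs.mark v).1 hv
    exact ⟨v, by simpa [ha] using this, .refl⟩

end ArrayPrograms

/-! ## The elementary graph programs -/

namespace CausalGraph

variable {V : Type}

/-- The size of a causal graph: nodes plus edges, plus one. -/
noncomputable def size [Fintype V] (G : CausalGraph V) : ℕ := Fintype.card V + G.numEdges + 1

theorem IsAncestral.mem_of_reach {G : CausalGraph V} {S : Set V} (hS : G.IsAncestral S) {u v : V}
    (h : Relation.ReflTransGen G.dir u v) (hv : v ∈ S) : u ∈ S := by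
  rw [← hS]; exact ⟨v, hv, h⟩

end CausalGraph

namespace AdjLists.Stores

open Comp

variable {V : Type} [Fintype V] {A : AdjLists V} {G : CausalGraph V} {S : Set V}

theorem verts_length_le (hA : A.Stores G S) : A.verts.length ≤ Fintype.card V :=
  hA.verts_nodup.length_le_card

theorem sum_verts_le (hA : A.Stores G S) (f : V → ℕ) : (A.verts.map f).sum ≤ ∑ v, f v := by
  classical
  rw [← List.sum_toFinset f hA.verts_nodup]
  exact Finset.sum_le_sum_of_subset (Finset.subset_univ _)

theorem sum_length_le_ncard {t : V → List V} (ht : ∀ v, (t v).Nodup) (E : Set (V × V))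
    (hE : ∀ v, ∀ u ∈ t v, (u, v) ∈ E) : ∑ v, (t v).length ≤ E.ncard := by
  classical
  have h : (Finset.univ.sigma fun v => (t v).toFinset).card = ∑ v, (t v).length := by
    rw [Finset.card_sigma]
    exact Finset.sum_congr rfl fun v _ => List.toFinset_card_of_nodup (ht v)
  rw [← h, Set.ncard_eq_toFinset_card']
  refine Finset.card_le_card_of_injOn (fun p => (p.2, p.1)) ?_ ?_
  · rintro ⟨v, u⟩ h
    simpa using hE v u (by simpa using h)
  · rintro ⟨v, u⟩ _ ⟨v', u'⟩ _ h
    simp only [Prod.mk.injEq] at h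
    rw [h.1, h.2]

/-- The factor is 2 because a directed edge is listed once among parents and once among children,
and a bidirected edge at both of its ends. -/
theorem sum_degrees_le (hA : A.Stores G S) :
    ∑ v, ((A.pa v).length + (A.sp v).length + (A.ch v).length) ≤ 2 * G.numEdges := by
  classical
  have h1 : ∑ v, (A.pa v).length ≤ {e : V × V | G.dir e.1 e.2}.ncard :=
    sum_length_le_ncard hA.pa_nodup _ fun v u h => ((hA.mem_pa u v).1 h).2.2
  have h2 : ∑ v, (A.ch v).length ≤ {e : V × V | G.dir e.2 e.1}.ncard :=
    sum_length_le_ncard hA.ch_nodup _ fun v u h => ((hA.mem_ch u v).1 h).2.2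
  have h2' : {e : V × V | G.dir e.2 e.1}.ncard ≤ {e : V × V | G.dir e.1 e.2}.ncard :=
    Set.ncard_le_ncard_of_injOn Prod.swap (fun e he => he) Prod.swap_injective.injOn
  have h3 : ∑ v, (A.sp v).length ≤ 2 * G.bi.edgeSet.ncard := by
    rw [Set.ncard_eq_toFinset_card', ← SimpleGraph.edgeFinset,
      ← SimpleGraph.sum_degrees_eq_twice_card_edges]
    refine Finset.sum_le_sum fun v _ => ?_
    rw [← List.toFinset_card_of_nodup (hA.sp_nodup v), ← SimpleGraph.card_neighborFinset_eq_degree]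
    refine Finset.card_le_card fun u hu => ?_
    rw [SimpleGraph.mem_neighborFinset]
    exact ((hA.mem_sp u v).1 (by simpa using hu)).2.2.symm
  rw [Finset.sum_add_distrib, Finset.sum_add_distrib]
  unfold CausalGraph.numEdges
  omega

theorem sum_pa_le (hA : A.Stores G S) : ∑ v, (A.pa v).length ≤ 2 * G.numEdges :=
  (Finset.sum_le_sum fun _ _ => by omega).trans hA.sum_degrees_le

theorem sum_sp_le (hA : A.Stores G S) : ∑ v, (A.sp v).length ≤ 2 * G.numEdges :=
  (Finset.sum_le_sum fun _ _ => by omega).trans hA.sum_degrees_le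

theorem sum_ch_le (hA : A.Stores G S) : ∑ v, (A.ch v).length ≤ 2 * G.numEdges :=
  (Finset.sum_le_sum fun _ _ => by omega).trans hA.sum_degrees_le

variable [DecidableEq V]

/-- Since `S` is ancestral, parents in `G` of nodes of `S` lie in `S`, so the stored subgraph loses
none of them; the same holds for ancestors in `spec_anSet`. Spouses and descendants may leave `S`,
so `spec_spSet` and `spec_deSet` describe only their part in `S`. -/
theorem spec_paSet (hA : A.Stores G S) (hS : G.IsAncestral S) {C : V → Bool}
    (hC : {v | C v = true} ⊆ S) :
    Spec (A.paSet C) (4 * G.size) (fun r => ∀ v, r v = true ↔ v ∈ G.Pa {v | C v = true}) := by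
  refine (spec_newArray.bind fun a ha => spec_foldlM
    (cost := fun v => 2 + (A.pa v).length)
    (fun pre (r : V → Bool) => ∀ u, r u = true ↔ ∃ v ∈ pre, C v = true ∧ (u = v ∨ u ∈ A.pa v))
    (fun b pre v _ hb => ?_) (by simp [ha])).mono ?_ fun r hr v => ?_
  · refine ((spec_getBit C v).bind (b := 1 + (A.pa v).length) fun c hc => ?_).le (by omega)
    subst hc
    cases h : C v
    · exact (spec_pure (by simpa [h, or_and_right, exists_or] using hb)).le (Nat.zero_le _)
    · refine (spec_setBits b (v :: A.pa v)).mono (by simp [add_comm]) fun r hr u => ?_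
      simp [hr, hb, h, or_and_right, exists_or]
  · have h1 := hA.sum_verts_le fun v => 2 + (A.pa v).length
    rw [Finset.sum_add_distrib] at h1
    simp only [Finset.sum_const, Finset.card_univ, smul_eq_mul] at h1
    have := hA.sum_pa_le
    unfold CausalGraph.size
    omega
  · rw [hr]
    constructor
    · rintro ⟨u, _, hu, rfl | h⟩
      · exact Or.inl hu
      · exact Or.inr ⟨u, hu, ((hA.mem_pa _ _).1 h).2.2⟩
    · rintro (h | ⟨u, hu, h⟩)
      · exact ⟨v, (hA.mem_verts v).2 (hC h), h, Or.inl rfl⟩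
      · exact ⟨u, (hA.mem_verts u).2 (hC hu), hu, Or.inr ((hA.mem_pa _ _).2
          ⟨hS.mem_of_reach (.single h) (hC hu), hC hu, h⟩)⟩

theorem spec_spSet (hA : A.Stores G S) {C : V → Bool} (hC : {v | C v = true} ⊆ S) :
    Spec (A.spSet C) (4 * G.size)
      (fun r => ∀ v, r v = true ↔ v ∈ S ∧ v ∈ G.Spo {v | C v = true}) := by
  refine (spec_newArray.bind fun a ha => spec_foldlM
    (cost := fun v => 1 + (A.sp v).length)
    (fun pre (r : V → Bool) => ∀ u, r u = true ↔ ∃ v ∈ pre, C v = true ∧ u ∈ A.sp v)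
    (fun b pre v _ hb => ?_) (by simp [ha])).mono ?_ fun r hr v => ?_
  · refine ((spec_getBit C v).bind (b := (A.sp v).length) fun c hc => ?_).le (by omega)
    subst hc
    cases h : C v
    · exact (spec_pure (by simpa [h, or_and_right, exists_or] using hb)).le (Nat.zero_le _)
    · refine (spec_setBits b (A.sp v)).mono le_rfl fun r hr u => ?_
      simp [hr, hb, h, or_and_right, exists_or]
  · have h1 := hA.sum_verts_le fun v => 1 + (A.sp v).length
    rw [Finset.sum_add_distrib] at h1
    simp only [Finset.sum_const, Finset.card_univ, smul_eq_mul] at h1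
    have := hA.sum_sp_le
    unfold CausalGraph.size
    omega
  · rw [hr]
    constructor
    · rintro ⟨u, _, hu, h⟩
      obtain ⟨h1, _, h2⟩ := (hA.mem_sp _ _).1 h
      exact ⟨h1, u, hu, h2⟩
    · rintro ⟨h, u, hu, h2⟩
      exact ⟨u, (hA.mem_verts u).2 (hC hu), hu, (hA.mem_sp _ _).2 ⟨h, hC hu, h2⟩⟩

omit [Fintype V] [DecidableEq V] in
theorem mem_filter_verts (hA : A.Stores G S) {C : V → Bool} (hC : {v | C v = true} ⊆ S) (v : V) :
    v ∈ A.verts.filter C ↔ C v = true := by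
  rw [List.mem_filter, hA.mem_verts]
  exact ⟨And.right, fun h => ⟨hC h, h⟩⟩

omit [DecidableEq V] in
theorem spec_filter_verts (hA : A.Stores G S) {O : Type} {p : V → Comp O Bool} {q : V → Bool}
    {c : ℕ} (hp : ∀ v, Spec (p v) c (fun r => r = q v)) :
    Spec (filterList p A.verts) ((c + 1) * G.size) (fun r => r = A.verts.filter q) := by
  refine (spec_filterList A.verts hp).le ?_
  have := hA.verts_length_le
  unfold CausalGraph.size
  nlinarith [Nat.zero_le (c * G.numEdges)]

theorem spec_select_verts (hA : A.Stores G S) {p : V → Prog V Bool} {q : V → Bool}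
    {c : ℕ} (hp : ∀ v, Spec (p v) c (fun r => r = q v)) :
    Spec (selectArray p A.verts) ((c + 3) * G.size)
      (fun r => ∀ v, r v = true ↔ v ∈ S ∧ q v = true) := by
  refine (spec_selectArray A.verts hp).mono ?_ fun r hr v => by rw [hr, hA.mem_verts]
  have := hA.verts_length_le
  unfold CausalGraph.size
  nlinarith [Nat.zero_le (c * G.numEdges)]

theorem spec_anSet (hA : A.Stores G S) (hS : G.IsAncestral S) {C : V → Bool}
    (hC : {v | C v = true} ⊆ S) :
    Spec (A.anSet C) (15 * G.size) (fun r => ∀ v, r v = true ↔ v ∈ G.An {v | C v = true}) := by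
  refine ((hA.spec_filter_verts (q := C) (c := 1) fun v => spec_getBit C v).bind
    (b := 13 * G.size) fun src hsrc => ?_).le (by omega)
  refine (spec_reach (nb := A.pa) (cost := fun _ => 1)
    (fun v => (spec_charge 1).bind (b := 0) fun _ _ => spec_pure rfl) src).mono ?_ fun r hr v => ?_
  · have h1 : src.length ≤ Fintype.card V := by
      subst hsrc; exact (List.length_filter_le _ _).trans hA.verts_length_le
    have h2 := hA.sum_pa_le
    simp only [Finset.sum_add_distrib, ← Finset.mul_sum, Finset.sum_const, Finset.card_univ,
      smul_eq_mul]
    unfold CausalGraph.size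
    omega
  · rw [hr]
    subst hsrc
    constructor
    · rintro ⟨a, ha, hav⟩
      refine ⟨a, (hA.mem_filter_verts hC a).1 ha, ?_⟩
      induction hav with
      | refl => exact .refl
      | tail _ h ih => exact .head ((hA.mem_pa _ _).1 h).2.2 ih
    · rintro ⟨a, ha, hva⟩
      refine ⟨a, (hA.mem_filter_verts hC a).2 ha, ?_⟩
      induction hva using Relation.ReflTransGen.head_induction_on with
      | refl => exact .refl
      | head h h' ih =>
        exact ih.tail ((hA.mem_pa _ _).2 ⟨hS.mem_of_reach (.head h h') (hC ha),
          hS.mem_of_reach h' (hC ha), h⟩)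

theorem spec_deSet (hA : A.Stores G S) (hS : G.IsAncestral S) {C : V → Bool}
    (hC : {v | C v = true} ⊆ S) :
    Spec (A.deSet C) (15 * G.size)
      (fun r => ∀ v, r v = true ↔ v ∈ S ∧ v ∈ G.De {v | C v = true}) := by
  refine ((hA.spec_filter_verts (q := C) (c := 1) fun v => spec_getBit C v).bind
    (b := 13 * G.size) fun src hsrc => ?_).le (by omega)
  refine (spec_reach (nb := A.ch) (cost := fun _ => 1)
    (fun v => (spec_charge 1).bind (b := 0) fun _ _ => spec_pure rfl) src).mono ?_ fun r hr v => ?_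
  · have h1 : src.length ≤ Fintype.card V := by
      subst hsrc; exact (List.length_filter_le _ _).trans hA.verts_length_le
    have h2 := hA.sum_ch_le
    simp only [Finset.sum_add_distrib, ← Finset.mul_sum, Finset.sum_const, Finset.card_univ,
      smul_eq_mul]
    unfold CausalGraph.size
    omega
  · rw [hr]
    subst hsrc
    constructor
    · rintro ⟨a, ha, hav⟩
      rw [hA.mem_filter_verts hC] at ha
      suffices v ∈ S ∧ Relation.ReflTransGen G.dir a v from ⟨this.1, a, ha, this.2⟩
      induction hav with
      | refl => exact ⟨hC ha, .refl⟩
      | tail _ h ih => exact ⟨((hA.mem_ch _ _).1 h).1, ih.2.tail ((hA.mem_ch _ _).1 h).2.2⟩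
    · rintro ⟨hv, a, ha, hav⟩
      refine ⟨a, (hA.mem_filter_verts hC a).2 ha, ?_⟩
      clear ha
      -- All nodes of a directed path ending in the ancestral set `S` are in `S`, so the whole path
      -- survives in the stored subgraph.
      induction hav using Relation.ReflTransGen.head_induction_on with
      | refl => exact .refl
      | head h h' ih =>
        exact ih.head ((hA.mem_ch _ _).2 ⟨hS.mem_of_reach h' hv, hS.mem_of_reach (.head h h') hv, h⟩)

theorem spec_cComp (hA : A.Stores G S) (X : V) :
    Spec (A.cComp X) (9 * G.size) (fun r => ∀ v, r v = true ↔ v ∈ G.cComponent S X) := by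
  refine (spec_reach (nb := A.sp) (cost := fun _ => 1)
    (fun v => (spec_charge 1).bind (b := 0) fun _ _ => spec_pure rfl) [X]).mono ?_ fun r hr v => ?_
  · have h2 := hA.sum_sp_le
    simp only [Finset.sum_add_distrib, ← Finset.mul_sum, Finset.sum_const, Finset.card_univ,
      smul_eq_mul, List.length_singleton]
    unfold CausalGraph.size
    omega
  · rw [hr]
    have : (fun a b => b ∈ A.sp a) = fun a b => a ∈ S ∧ b ∈ S ∧ G.bi.Adj a b := by
      funext a b
      rw [hA.mem_sp, G.bi.adj_comm]
      exact propext ⟨fun h => ⟨h.2.1, h.1, h.2.2⟩, fun h => ⟨h.2.1, h.1, h.2.2⟩⟩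
    simp [this, CausalGraph.cComponent]

theorem spec_diffSet (hA : A.Stores G S) (B C : V → Bool) :
    Spec (A.diffSet B C) (5 * G.size)
      (fun r => ∀ v, r v = true ↔ v ∈ S ∧ B v = true ∧ ¬ C v = true) := by
  refine (hA.spec_select_verts (c := 2) (q := fun v => B v && !C v) fun v => ?_).mono le_rfl
    fun r hr v => by simp [hr]
  exact (spec_getBit B v).bind (b := 1) fun _ h => (spec_getBit C v).bind (b := 0)
    fun _ h' => spec_pure (by rw [h, h'])

theorem spec_unionSet (hA : A.Stores G S) (B C : V → Bool) :
    Spec (A.unionSet B C) (5 * G.size)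
      (fun r => ∀ v, r v = true ↔ v ∈ S ∧ (B v = true ∨ C v = true)) := by
  refine (hA.spec_select_verts (c := 2) (q := fun v => B v || C v) fun v => ?_).mono le_rfl
    fun r hr v => by simp [hr]
  exact (spec_getBit B v).bind (b := 1) fun _ h => (spec_getBit C v).bind (b := 0)
    fun _ h' => spec_pure (by rw [h, h'])

omit [DecidableEq V] in
theorem spec_eqSet (hA : A.Stores G S) (B C : V → Bool) :
    Spec (A.eqSet B C) (3 * G.size)
      (fun r => r = true ↔ ∀ v ∈ S, B v = C v) := by
  refine ((hA.spec_filter_verts (c := 2) (q := fun v => B v != C v) fun v => ?_).bind (b := 0)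
    fun r hr => spec_pure ?_).le (by omega)
  · exact (spec_getBit B v).bind (b := 1) fun _ h => (spec_getBit C v).bind (b := 0)
      fun _ h' => spec_pure (by rw [h, h'])
  · subst hr
    simp [List.isEmpty_iff, List.filter_eq_nil_iff, hA.mem_verts]

theorem spec_restrictTable (hA : A.Stores G S) (t : V → List V)
    (ht : ∑ v, (t v).length ≤ 2 * G.numEdges) (B : V → Bool) :
    Spec (restrictTable A.verts t B) (5 * G.size)
      (fun r => ∀ v, r v = if v ∈ A.verts ∧ B v = true then (t v).filter B else []) := by
  refine ((spec_charge _).bind fun _ _ => spec_foldlM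
    (cost := fun v => 3 + 2 * (t v).length)
    (fun pre (r : V → List V) => ∀ u, r u = if u ∈ pre ∧ B u = true then (t u).filter B else [])
    (fun b pre v _ hb => ?_) (by simp)).mono ?_ fun r hr v => ?_
  · refine ((spec_getBit B v).bind (b := 2 + 2 * (t v).length) fun c hc => ?_).le (by omega)
    subst hc
    cases h : B v
    · refine (spec_pure fun u => ?_).le (Nat.zero_le _)
      rw [hb]
      by_cases huv : u = v
      · subst huv; simp [h]
      · simp [huv]
    · refine ((spec_filterList (t v) (c := 1) (q := B) fun u => spec_getBit B u).bind
        (b := 1 + 0) fun l hl => (spec_charge 1).bind fun _ _ => spec_pure fun u => ?_).le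
        (by omega)
      subst hl
      by_cases huv : u = v
      · subst huv; simp [h]
      · simp [huv, hb]
  · have h1 := hA.sum_verts_le fun v => 3 + 2 * (t v).length
    rw [Finset.sum_add_distrib, ← Finset.mul_sum] at h1
    simp only [Finset.sum_const, Finset.card_univ, smul_eq_mul] at h1
    unfold CausalGraph.size
    omega
  · exact hr v

theorem spec_induce (hA : A.Stores G S) (B : V → Bool) :
    Spec (A.induce B) (17 * G.size) (fun r => r.Stores G (S ∩ {v | B v = true})) := by
  refine ((hA.spec_filter_verts (q := B) (c := 1) fun v => spec_getBit B v).bind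
    (b := 5 * G.size + (5 * G.size + (5 * G.size + 0))) fun vs hvs => ?_).le (by omega)
  refine (hA.spec_restrictTable A.pa hA.sum_pa_le B).bind fun tp hp => ?_
  refine (hA.spec_restrictTable A.ch hA.sum_ch_le B).bind fun tc hc => ?_
  refine (hA.spec_restrictTable A.sp hA.sum_sp_le B).bind fun ts hs => spec_pure ?_
  subst hvs
  have nodup : ∀ {t : V → List V} (_ : ∀ v, (t v).Nodup) (v : V),
      (if v ∈ A.verts ∧ B v = true then (t v).filter B else []).Nodup := by
    intro t ht v
    split_ifs
    · exact (ht v).filter _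
    · exact List.nodup_nil
  have mem : ∀ {t : V → List V} {R : V → V → Prop} (_ : ∀ u v, u ∈ t v ↔ u ∈ S ∧ v ∈ S ∧ R u v)
      (u v : V), (u ∈ if v ∈ A.verts ∧ B v = true then (t v).filter B else []) ↔
        u ∈ S ∩ {v | B v = true} ∧ v ∈ S ∩ {v | B v = true} ∧ R u v := by
    intro t R ht u v
    split_ifs with h
    · rw [hA.mem_verts] at h
      simp [List.mem_filter, ht, h]; tauto
    · rw [hA.mem_verts] at h
      simp; tauto
  exact
    { verts_nodup := hA.verts_nodup.filter _
      mem_verts := fun v => by simp [List.mem_filter, hA.mem_verts]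
      pa_nodup := fun v => by simpa only [hp] using nodup hA.pa_nodup v
      mem_pa := fun u v => by simpa only [hp] using mem (R := fun u v => G.dir u v) hA.mem_pa u v
      ch_nodup := fun v => by simpa only [hc] using nodup hA.ch_nodup v
      mem_ch := fun u v => by simpa only [hc] using mem (R := fun u v => G.dir v u) hA.mem_ch u v
      sp_nodup := fun v => by simpa only [hs] using nodup hA.sp_nodup v
      mem_sp := fun u v => by
        simpa only [hs] using mem (R := fun u v => G.bi.Adj u v) hA.mem_sp u v }

end AdjLists.Stores

/-! ## Ancestral c-components -/

namespace CausalGraph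

open Relation

variable {V : Type} {G : CausalGraph V}

theorem subset_An (B : Set V) : B ⊆ G.An B := fun v hv => ⟨v, hv, .refl⟩

theorem subset_Pa (B : Set V) : B ⊆ G.Pa B := Set.subset_union_left

theorem Pa_mono {B C : Set V} (h : B ⊆ C) : G.Pa B ⊆ G.Pa C := by
  rintro v (hv | ⟨u, hu, hvu⟩)
  · exact Or.inl (h hv)
  · exact Or.inr ⟨u, h hu, hvu⟩

theorem isAncestral_An (B : Set V) : G.IsAncestral (G.An B) := by
  refine Set.Subset.antisymm ?_ (subset_An _)
  rintro u ⟨v, ⟨w, hw, hvw⟩, huv⟩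
  exact ⟨w, hw, huv.trans hvw⟩

theorem IsAncestral.An_subset {T B : Set V} (hT : G.IsAncestral T) (h : B ⊆ T) : G.An B ⊆ T := by
  rintro u ⟨v, hv, huv⟩
  exact hT.mem_of_reach huv (h hv)

theorem IsAncestral.Pa_subset {T B : Set V} (hT : G.IsAncestral T) (h : B ⊆ T) : G.Pa B ⊆ T := by
  rintro u (hu | ⟨v, hv, huv⟩)
  · exact h hu
  · exact hT.mem_of_reach (.single huv) (h hv)

theorem IsAncestral.diff_De {T : Set V} (hT : G.IsAncestral T) (B : Set V) :
    G.IsAncestral (T \ G.De B) := by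
  refine Set.Subset.antisymm ?_ (subset_An _)
  rintro u ⟨v, ⟨hv, hvB⟩, huv⟩
  exact ⟨hT.mem_of_reach huv hv, fun ⟨b, hb, hbu⟩ => hvB ⟨b, hb, hbu.trans huv⟩⟩

theorem self_mem_cComponent (T : Set V) (X : V) : X ∈ G.cComponent T X := .refl

theorem cComponent_subset {T : Set V} {X : V} (hX : X ∈ T) : G.cComponent T X ⊆ T := by
  intro v hv
  induction hv with
  | refl => exact hX
  | tail _ h _ => exact h.2.1

theorem cComponent_mono {T U : Set V} (h : T ⊆ U) (X : V) :
    G.cComponent T X ⊆ G.cComponent U X :=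
  fun v hv => ReflTransGen.mono
    (r := fun a b => a ∈ T ∧ b ∈ T ∧ G.bi.Adj a b) (p := fun a b => a ∈ U ∧ b ∈ U ∧ G.bi.Adj a b)
    (fun _ _ ⟨h1, h2, h3⟩ => ⟨h h1, h h2, h3⟩) X v hv

theorem mem_cComponent_of_Spo {T : Set V} {X s : V} (hX : X ∈ T) (hs : s ∈ T)
    (h : s ∈ G.Spo (G.cComponent T X)) : s ∈ G.cComponent T X := by
  obtain ⟨c, hc, hsc⟩ := h
  exact ReflTransGen.tail hc ⟨cComponent_subset hX hc, hs, hsc.symm⟩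

/-- Every initial segment of a bidirected path from `X` ends in the component, so the path itself
runs inside the component. -/
theorem subset_cComponent_cComponent (T : Set V) (X : V) :
    G.cComponent T X ⊆ G.cComponent (G.cComponent T X) X := by
  intro v hv
  induction hv with
  | refl => exact .refl
  | tail h1 h2 ih => exact ih.tail ⟨h1, h1.tail h2, h2.2.2⟩

/-- `C` is an ancestral c-component relative to `X`, within the set `S` of nodes. -/
def IsAC (G : CausalGraph V) (S : Set V) (X : V) (C : Set V) : Prop :=
  ∃ T : Set V, G.IsAncestral T ∧ T ⊆ S ∧ X ∈ T ∧ G.cComponent T X = C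

variable {S : Set V} {X : V} {I R C : Set V}

theorem isAC_cComponent {T : Set V} (hT : G.IsAncestral T) (hTS : T ⊆ S) (hX : X ∈ T) :
    G.IsAC S X (G.cComponent T X) := ⟨T, hT, hTS, hX, rfl⟩

/-! ### Monotonicity and recovery of ancestral c-components. -/

namespace IsAC

theorem self_mem (hC : G.IsAC S X C) : X ∈ C := by
  obtain ⟨T, _, _, _, rfl⟩ := hC
  exact self_mem_cComponent T X

theorem subset (hC : G.IsAC S X C) : C ⊆ S := by
  obtain ⟨T, _, hTS, hX, rfl⟩ := hC
  exact (cComponent_subset hX).trans hTS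

/-- The paths joining `C` to `X` run inside `C`. Therefore `U` need not be ancestral, which matters
for `U = R \ De({s})`. -/
theorem subset_cComponent (hC : G.IsAC S X C) {U : Set V} (h : C ⊆ U) :
    C ⊆ G.cComponent U X := by
  obtain ⟨T, _, _, _, rfl⟩ := hC
  exact (subset_cComponent_cComponent T X).trans (cComponent_mono h X)

/-- The ancestral set `T` behind `C` contains `Pa(C)`, hence all ancestors of `B`. -/
theorem cComponent_An_subset (hC : G.IsAC S X C) {B : Set V} (h : B ⊆ G.Pa C) :
    G.cComponent (G.An B) X ⊆ C := by
  obtain ⟨T, hT, _, hX, rfl⟩ := hC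
  exact cComponent_mono (hT.An_subset (h.trans (hT.Pa_subset (cComponent_subset hX)))) X

/-- `Pa(C)` lies between `C` and the ancestral set that defines `C`, and both ends give the
component `C`. -/
theorem cComponent_Pa (hC : G.IsAC S X C) : G.cComponent (G.Pa C) X = C := by
  refine Set.Subset.antisymm ?_ (hC.subset_cComponent (subset_Pa C))
  obtain ⟨T, hT, _, hX, rfl⟩ := hC
  exact cComponent_mono (hT.Pa_subset (cComponent_subset hX)) X

/-- A spouse of an ancestral c-component that is an ancestor of one of its parents
belongs to it. -/
theorem mem_of_Spo_of_reach (hC : G.IsAC S X C) {s v : V} (hs : s ∈ G.Spo C) (hv : v ∈ G.Pa C)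
    (h : ReflTransGen G.dir s v) : s ∈ C := by
  obtain ⟨T, hT, _, hX, rfl⟩ := hC
  -- `T` contains `Pa(C)`, so by ancestrality it contains `s`; a bidirected neighbour of the
  -- component inside `T` belongs to the component.
  exact mem_cComponent_of_Spo hX (hT.mem_of_reach h (hT.Pa_subset (cComponent_subset hX) hv)) hs

/-- A directed path from a spouse of `C` to such a `v` would continue into `Pa(C)` and put the
spouse into `C`. For `C = I` this shows that no candidate `D` of FindAAC is `X` or an ancestor of
`Pa(I)`. -/
theorem not_mem_De (hC : G.IsAC S X C) {v : V} (hv : v ∈ G.An (G.Pa C)) :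
    v ∉ G.De (G.Spo C \ G.Pa C) := by
  rintro ⟨s, ⟨hs, hs'⟩, hsv⟩
  obtain ⟨c, hc, hvc⟩ := hv
  exact hs' (subset_Pa C (hC.mem_of_Spo_of_reach hs hc (hsv.trans hvc)))

/-- Since `X` is in both sets, the conditioning set determines `Pa(C)`, and `cComponent_Pa` recovers
`C` from it. This is why no relation is listed twice for the same `X`. -/
theorem eq_of_Pa_diff_eq {S' : Set V} {C' : Set V} (hC : G.IsAC S X C) (hC' : G.IsAC S' X C')
    (h : G.Pa C \ {X} = G.Pa C' \ {X}) : C = C' := by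
  have key : ∀ {S D}, G.IsAC S X D → insert X (G.Pa D \ {X}) = G.Pa D := fun hD => by
    rw [Set.insert_sdiff_singleton, Set.insert_eq_of_mem (subset_Pa _ hD.self_mem)]
  rw [← hC.cComponent_Pa, ← hC'.cComponent_Pa, ← key hC, ← key hC', h]

/-- If `I ⊂ R`, then some spouse of `I` lies in `R \ I`. -/
theorem exists_Spo (hI : G.IsAC S X I) (hR : G.IsAC S X R) (h : ¬ R ⊆ I) :
    ∃ s ∈ R, s ∈ G.Spo I ∧ s ∉ I := by
  by_contra! hcon
  refine h fun v hv => ?_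
  have hv' := hR.subset_cComponent subset_rfl hv
  -- Follow a path from `X` to `v` inside `R`: if it never leaves `I` through a spouse, it stays in
  -- `I`.
  induction hv' with
  | refl => exact hI.self_mem
  | tail _ h2 ih =>
    by_contra hc
    exact hc (hcon _ h2.2.1 ⟨_, ih h2.1, h2.2.2.symm⟩)

/-! ### Splitting the interval between two ancestral c-components at a spouse -/

variable {s : V}

theorem extend (hI : G.IsAC S X I) (hR : G.IsAC S X R) (hIR : I ⊆ R) (hsR : s ∈ R) :
    G.IsAC S X (G.cComponent (G.An (I ∪ {s})) X) ∧ I ⊆ G.cComponent (G.An (I ∪ {s})) X ∧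
      G.cComponent (G.An (I ∪ {s})) X ⊆ R := by
  have hsub : I ∪ {s} ⊆ R := Set.union_subset hIR (by simpa using hsR)
  have hI' : I ⊆ G.An (I ∪ {s}) := Set.subset_union_left.trans (subset_An _)
  refine ⟨?_, hI.subset_cComponent hI', hR.cComponent_An_subset (hsub.trans (subset_Pa R))⟩
  obtain ⟨T, hT, hTS, hX, rfl⟩ := hR
  exact isAC_cComponent (isAncestral_An _)
    ((hT.An_subset (hsub.trans (cComponent_subset hX))).trans hTS) (hI' hI.self_mem)

theorem mem_extend (hI : G.IsAC S X I) (hs : s ∈ G.Spo I) :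
    s ∈ G.cComponent (G.An (I ∪ {s})) X := by
  have hI' : I ⊆ G.An (I ∪ {s}) := Set.subset_union_left.trans (subset_An _)
  obtain ⟨i, hi, hsi⟩ := hs
  exact mem_cComponent_of_Spo (hI' hI.self_mem) (subset_An _ (by simp))
    ⟨i, hI.subset_cComponent hI' hi, hsi⟩

theorem extend_subset (hC : G.IsAC S X C) (hIC : I ⊆ C) (hs : s ∈ C) :
    G.cComponent (G.An (I ∪ {s})) X ⊆ C :=
  hC.cComponent_An_subset
    ((Set.union_subset hIC (by simpa using hs)).trans (subset_Pa C))

/-- If `C` contained a descendant of its spouse `s`, then `s` would be an ancestor of `C` and hence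
a member. -/
theorem disjoint_De (hC : G.IsAC S X C) (hsC : s ∈ G.Spo C) (hs : s ∉ C) :
    ∀ v ∈ C, v ∉ G.De {s} := by
  rintro v hv ⟨u, hu, huv⟩
  rw [Set.mem_singleton_iff] at hu
  subst hu
  exact hs (hC.mem_of_Spo_of_reach hsC (subset_Pa C hv) huv)

theorem subset_shrink (hC : G.IsAC S X C) (hsC : s ∈ G.Spo C) (hs : s ∉ C) (hCR : C ⊆ R) :
    C ⊆ G.cComponent (R \ G.De {s}) X :=
  hC.subset_cComponent fun v hv => ⟨hCR hv, hC.disjoint_De hsC hs v hv⟩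

theorem shrink (hI : G.IsAC S X I) (hR : G.IsAC S X R) (hIR : I ⊆ R) (hsI : s ∈ G.Spo I)
    (hs : s ∉ I) :
    G.IsAC S X (G.cComponent (R \ G.De {s}) X) ∧ G.cComponent (R \ G.De {s}) X ⊆ R \ {s} := by
  have hXD : X ∉ G.De {s} := hI.disjoint_De hsI hs X hI.self_mem
  constructor
  · obtain ⟨T, hT, hTS, hX, rfl⟩ := hR
    -- `R` itself need not be ancestral. The witness removes `De({s})` from the ancestral set `T`
    -- behind `R`; the component of `X` there lies in `R` anyway, so it is also the component in `R
    -- \ De({s})`.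
    refine ⟨T \ G.De {s}, hT.diff_De _, Set.sdiff_subset.trans hTS, ⟨hX, hXD⟩, ?_⟩
    refine Set.Subset.antisymm ?_ (cComponent_mono (Set.sdiff_subset_sdiff_left
      (cComponent_subset hX)) X)
    intro v hv
    have hsub := cComponent_mono (G := G) (Set.sdiff_subset (s := T) (t := G.De {s})) X
    have hD := cComponent_subset (G := G) (show X ∈ T \ G.De {s} from ⟨hX, hXD⟩)
    refine cComponent_mono (T := G.cComponent (T \ G.De {s}) X) (fun u hu => ?_) X
      (subset_cComponent_cComponent _ X hv)
    exact ⟨hsub hu, (hD hu).2⟩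
  · refine (cComponent_subset (T := R \ G.De {s}) ⟨hR.self_mem, hXD⟩).trans
      (Set.sdiff_subset_sdiff_right ?_)
    rintro v hv
    exact ⟨s, rfl, by rw [Set.mem_singleton_iff.1 hv]⟩

end IsAC

/-! ## Separation -/

/-- One move of the search for active walks given `Z`; see `AdjLists.activeMoves`. -/
def ActiveStep (G : CausalGraph V) (S Z : Set V) (a b : V × Bool) : Prop :=
  b.1 ∈ S ∧ a.1 ∈ S ∧
    (((a.2 = true → a.1 ∈ G.An Z) ∧ (a.2 = false → a.1 ∉ Z) ∧
        ((b.2 = false ∧ G.dir b.1 a.1) ∨ (b.2 = true ∧ G.bi.Adj b.1 a.1))) ∨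
      (a.1 ∉ Z ∧ b.2 = true ∧ G.dir a.1 b.1))

/-- `Z` separates `X` from `D` in the subgraph induced on `S`. -/
def Separates (G : CausalGraph V) (S Z : Set V) (X D : V) : Prop :=
  ∀ e, ¬ ReflTransGen (G.ActiveStep S Z) (X, false) (D, e)

/-- The set `S⁺ \ Pa(C)` of the relation of `C`. -/
def indepSet (G : CausalGraph V) (S : Set V) (C : Set V) : Set V :=
  (S \ G.De (G.Spo C \ G.Pa C)) \ G.Pa C

/-- If `X` has no children in `S` and `Z` contains `Pa(I) \ {X}`, then every node of `An(I ∪ Z)`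
other than `X` is an ancestor of `Z`. -/
theorem mem_An_of_ne {I Z : Set V} (hX : X ∈ I) (hIZ : G.Pa I \ {X} ⊆ Z)
    (hsink : ∀ v ∈ S, ¬ G.dir X v) (hIS : I ∪ Z ⊆ S) {v : V}
    (hv : v ∈ G.An (I ∪ Z)) (hne : v ≠ X) : v ∈ G.An Z := by
  obtain ⟨w, hw, hvw⟩ := hv
  have hwZ : w = X ∨ w ∈ Z := by
    rcases hw with hw | hw
    · by_cases h : w = X
      · exact Or.inl h
      · exact Or.inr (hIZ ⟨subset_Pa I hw, h⟩)
    · exact Or.inr hw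
  rcases hwZ with rfl | hwZ
  -- A nontrivial directed path to `X` passes through a parent of `X`, which lies in `Pa(I) \ {X}`
  -- and so in `Z`.
  · rcases ReflTransGen.cases_tail hvw with h | ⟨u, hvu, huw⟩
    · exact absurd h.symm hne
    · refine ⟨u, hIZ ⟨Or.inr ⟨w, hX, huw⟩, ?_⟩, hvu⟩
      rintro rfl
      exact hsink u (hIS (Or.inl hX)) huw
  · exact ⟨w, hwZ, hvw⟩

/-- A separator between `Pa(I)` and `Pa(R)` yields an admissible ancestral c-component
between `I` and `R`. -/
theorem Separates.exists_indep {Z : Set V} {D : V} (hS : G.IsAncestral S)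
    (hsink : ∀ v ∈ S, ¬ G.dir X v) (hI : G.IsAC S X I) (hR : G.IsAC S X R) (hIR : I ⊆ R)
    (hIZ : G.Pa I \ {X} ⊆ Z) (hZR : Z ⊆ G.Pa R) (hXZ : X ∉ Z) (hDS : D ∈ S)
    (hDI : D ∉ G.An I) (hsep : G.Separates S Z X D) :
    G.IsAC S X (G.cComponent (G.An (I ∪ Z)) X) ∧ I ⊆ G.cComponent (G.An (I ∪ Z)) X ∧
      G.cComponent (G.An (I ∪ Z)) X ⊆ R ∧
      D ∈ G.indepSet S (G.cComponent (G.An (I ∪ Z)) X) := by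
  have hIA : I ⊆ G.An (I ∪ Z) := Set.subset_union_left.trans (subset_An _)
  have hXA := hIA hI.self_mem
  have hsub : I ∪ Z ⊆ G.Pa R := Set.union_subset (hIR.trans (subset_Pa R)) hZR
  have hsubS : I ∪ Z ⊆ S := hsub.trans (hS.Pa_subset hR.subset)
  have hAS : G.An (I ∪ Z) ⊆ S := hS.An_subset hsubS
  have hXS : X ∈ S := hI.subset hI.self_mem
  have hDX : D ≠ X := by rintro rfl; exact hDI (subset_An I hI.self_mem)
  have hanc : ∀ {v}, v ∈ G.An (I ∪ Z) → v ≠ X → v ∈ G.An Z := fun hv hne =>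
    mem_An_of_ne hI.self_mem hIZ hsink hsubS hv hne
  -- from a node of the component, the search moves on as from a collider
  have hspouse : ∀ {c u}, c ∈ G.cComponent (G.An (I ∪ Z)) X → u ∈ S → G.bi.Adj u c →
      (c = X ∨ ReflTransGen (G.ActiveStep S Z) (X, false) (c, true)) →
      ReflTransGen (G.ActiveStep S Z) (X, false) (u, true) := by
    intro c u hc hu huc hreach
    have hcA := cComponent_subset hXA hc
    by_cases hcX : c = X
    · subst hcX
      exact .single ⟨hu, hXS, Or.inl ⟨by simp, fun _ => hXZ, Or.inr ⟨rfl, huc⟩⟩⟩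
    · exact (hreach.resolve_left hcX).tail
        ⟨hu, hAS hcA, Or.inl ⟨fun _ => hanc hcA hcX, by simp, Or.inr ⟨rfl, huc⟩⟩⟩
  have hreach : ∀ c ∈ G.cComponent (G.An (I ∪ Z)) X,
      c = X ∨ ReflTransGen (G.ActiveStep S Z) (X, false) (c, true) := by
    intro c hc
    induction hc with
    | refl => exact Or.inl rfl
    | tail h1 h2 ih => exact Or.inr (hspouse h1 (hAS h2.2.1) h2.2.2.symm ih)
  refine ⟨isAC_cComponent (isAncestral_An _) hAS hXA, hI.subset_cComponent hIA,
    hR.cComponent_An_subset hsub, ⟨hDS, ?_⟩, ?_⟩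
  -- Suppose `D` descends from a spouse `s` of the component outside its parents. Then `s` is not in
  -- `An(I ∪ Z)`, or it would have joined the component. So no node on the path from `s` to `D` is
  -- in `Z`, and the walk from `X` through colliders to `s` and down to `D` is active.
  · rintro ⟨s, ⟨⟨c, hc, hsc⟩, hsP⟩, hsD⟩
    have hsS : s ∈ S := hS.mem_of_reach hsD hDS
    have hsA : s ∉ G.An (I ∪ Z) := fun hsA =>
      hsP (subset_Pa _ (mem_cComponent_of_Spo hXA hsA ⟨c, hc, hsc⟩))
    refine hsep true ?_
    suffices ∀ v, ReflTransGen G.dir s v → v ∈ S →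
        ReflTransGen (G.ActiveStep S Z) (X, false) (v, true) from this D hsD hDS
    intro v hv
    induction hv with
    | refl => intro _; exact hspouse hc hsS hsc (hreach c hc)
    | tail hsb hbv ih =>
      intro hvS
      have hbS := hS.mem_of_reach (.single hbv) hvS
      exact (ih hbS).tail ⟨hvS, hbS, Or.inr ⟨fun hb => hsA ⟨_, Or.inr hb, hsb⟩, rfl, hbv⟩⟩
  · rintro (hD | ⟨c, hc, hDc⟩)
    · exact hsep true ((hreach D hD).resolve_left hDX)
    -- Here `D` is a parent of `c`. As `c` is not `X`, it was entered by an arrowhead and is an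
    -- ancestor of `Z`, so it is an open collider between the walk and `D → c`.
    · have hcX : c ≠ X := by
        rintro rfl
        exact hDI ⟨c, hI.self_mem, .single hDc⟩
      have hcA := cComponent_subset hXA hc
      exact hsep false (((hreach c hc).resolve_left hcX).tail
        ⟨hDS, hAS hcA, Or.inl ⟨fun _ => hanc hcA hcX, by simp, Or.inl ⟨rfl, hDc⟩⟩⟩)

/-- An admissible ancestral c-component between `I` and `R` yields a separator. -/
theorem IsAC.separates {D : V} (hS : G.IsAncestral S)
    (hsink : ∀ v ∈ S, ¬ G.dir X v) (hC : G.IsAC S X C)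
    (hIC : I ⊆ C) (hCR : C ⊆ R) (hD : D ∈ G.indepSet S C) :
    G.Separates S (G.An ({X, D} ∪ G.Pa I) ∩ (G.Pa R \ {X, D})) X D := by
  obtain ⟨⟨hDS, hDD⟩, hDP⟩ := hD
  have hXC := hC.self_mem
  have hDX : D ≠ X := by rintro rfl; exact hDP (subset_Pa C hXC)
  set A := G.An ({X, D} ∪ G.Pa I) with hA
  set Z := A ∩ (G.Pa R \ {X, D}) with hZ
  have hAanc : G.IsAncestral A := isAncestral_An _
  have hDA : D ∈ A := subset_An _ (by simp)
  have hAnZ : G.An Z ⊆ A := hAanc.An_subset Set.inter_subset_left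
  -- spouses of `C` in `A` belong to `C`
  have hsp : ∀ {c u}, c ∈ C → u ∈ A → G.bi.Adj u c → u ∈ C := by
    intro c u hc hu huc
    have huS : u ∈ G.Spo C := ⟨c, hc, huc⟩
    have hback : ∀ w ∈ G.Pa C, ReflTransGen G.dir u w → u ∈ C := fun w hw h =>
      hC.mem_of_Spo_of_reach huS hw h
    obtain ⟨w, hw, huw⟩ := hu
    rcases hw with (rfl | hw) | hw
    · exact hback w (subset_Pa C hXC) huw
    · rw [Set.mem_singleton_iff] at hw
      subst hw
      by_contra huC
      exact hDD ⟨u, ⟨huS, fun hP => huC (hback u hP .refl)⟩, huw⟩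
    · exact hback w (Pa_mono hIC hw) huw
  have hmemZ : ∀ {v}, v ∈ A → v ∈ G.Pa C → v ≠ X → v ∈ Z := fun hvA hvC hvX =>
    ⟨hvA, Pa_mono hCR hvC, by rintro (h | h); exacts [hvX h, hDP (h ▸ hvC)]⟩
  have hXAn : X ∉ G.An Z := by
    rintro ⟨w, hw, hXw⟩
    have hwS : w ∈ S := by
      refine hS.An_subset ?_ hw.1
      refine Set.union_subset ?_ (hS.Pa_subset (hIC.trans hC.subset))
      rintro v (rfl | hv)
      · exact hC.subset hXC
      · rw [Set.mem_singleton_iff.1 hv]; exact hDS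
    rcases ReflTransGen.cases_head hXw with h | ⟨u, hXu, huw⟩
    · exact hw.2.2 (Or.inl h.symm)
    · exact hsink u (hS.mem_of_reach huw hwS) hXu
  -- The states an active walk can visit: nodes outside `A` entered by an arrowhead, the start,
  -- nodes of `C` in `A` entered by an arrowhead, and nodes of `Pa(C)` in `A` entered by a tail.
  -- None of them is `D`, which is in `A` but not in `Pa(C)`.
  let Inv : V × Bool → Prop := fun a =>
    (a.1 ∉ A ∧ a.2 = true) ∨ (a.1 = X ∧ a.2 = false) ∨ (a.1 ∈ A ∧ a.1 ∈ C ∧ a.2 = true) ∨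
      (a.1 ∈ A ∧ a.1 ∈ G.Pa C ∧ a.1 ≠ X ∧ a.2 = false)
  have hstep : ∀ a b, G.ActiveStep S Z a b → Inv a → Inv b := by
    rintro ⟨v, d⟩ ⟨u, e⟩ ⟨huS, hvS, h⟩ hv
    simp only at huS hvS h
    have huX : G.dir u v → u ≠ X := by rintro huv rfl; exact hsink v hvS huv
    rcases hv with ⟨hvA, hd⟩ | ⟨hvX, hd⟩ | ⟨hvA, hvC, hd⟩ | ⟨hvA, hvC, hvX, hd⟩ <;>
      simp only at hd <;> subst hd
    -- Outside `A` a node is never an open collider, since `An(Z) ⊆ A`. The walk can only go on to a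
    -- child, which again is outside the ancestral set `A`.
    · rcases h with ⟨h, _⟩ | ⟨_, he, hvu⟩
      · exact absurd (hAnZ (h rfl)) hvA
      · exact Or.inl ⟨fun hu => hvA (hAanc.mem_of_reach (.single hvu) hu), he⟩
    · subst hvX
      have hXA : v ∈ A := subset_An _ (by simp)
      rcases h with ⟨_, _, ⟨he, huv⟩ | ⟨he, huv⟩⟩ | ⟨_, _, hvu⟩
      · exact Or.inr (Or.inr (Or.inr ⟨hAanc.mem_of_reach (.single huv) hXA,
          Or.inr ⟨v, hXC, huv⟩, huX huv, he⟩))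
      · by_cases huA : u ∈ A
        · exact Or.inr (Or.inr (Or.inl ⟨huA, hsp hXC huA huv, he⟩))
        · exact Or.inl ⟨huA, he⟩
      · exact absurd hvu (hsink u huS)
    · rcases h with ⟨h, _, ⟨he, huv⟩ | ⟨he, huv⟩⟩ | ⟨hvZ, _, hvu⟩
      · exact Or.inr (Or.inr (Or.inr ⟨hAanc.mem_of_reach (.single huv) hvA,
          Or.inr ⟨v, hvC, huv⟩, huX huv, he⟩))
      · by_cases huA : u ∈ A
        · exact Or.inr (Or.inr (Or.inl ⟨huA, hsp hvC huA huv, he⟩))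
        · exact Or.inl ⟨huA, he⟩
      · by_cases hvX : v = X
        · subst hvX; exact absurd hvu (hsink u huS)
        · exact absurd (hmemZ hvA (subset_Pa C hvC) hvX) hvZ
    -- A node entered by a tail can only be passed as a non-collider, but it lies in `Z`: the walk
    -- ends here.
    · have hvZ := hmemZ hvA hvC hvX
      rcases h with ⟨_, h, _⟩ | ⟨h, _⟩
      · exact absurd hvZ (h rfl)
      · exact absurd hvZ h
  intro e he
  have hInv : Inv (D, e) := by
    generalize hb : (D, e) = b at he
    clear hb
    induction he with
    | refl => exact Or.inr (Or.inl ⟨rfl, rfl⟩)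
    | tail _ h ih => exact hstep _ _ h ih
  rcases hInv with h | h | h | h
  · exact h.1 hDA
  · exact hDX h.1
  · exact hDP (subset_Pa C h.2.1)
  · exact hDP h.2.1

/-! ### Consistent orderings -/

section Order

variable [DecidableEq V] {ord : List V}

theorem IsConsistentOrder.isAncestral_upTo (h : G.IsConsistentOrder ord) (X : V) :
    G.IsAncestral (upTo ord X) := by
  refine Set.Subset.antisymm ?_ (subset_An _)
  rintro u ⟨v, hv, huv⟩
  by_contra hu
  have h1 : ord.idxOf v ≤ ord.idxOf X := hv
  have h2 : ¬ ord.idxOf u ≤ ord.idxOf X := hu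
  exact h.2.2 v u (by omega) ⟨v, rfl, huv⟩

theorem IsConsistentOrder.not_dir (h : G.IsConsistentOrder ord) (X : V) :
    ∀ v ∈ upTo ord X, ¬ G.dir X v := by
  intro v hv hXv
  rcases Nat.lt_or_eq_of_le (show ord.idxOf v ≤ ord.idxOf X from hv) with h1 | h1
  · exact h.2.2 v X h1 ⟨v, rfl, .single hXv⟩
  · rw [List.idxOf_inj (h.2.1 v)] at h1
    subst h1
    exact G.acyclic v (.single hXv)

theorem mem_AC_iff {C : Set V} : C ∈ G.AC ord X ↔ G.IsAC (upTo ord X) X C := Iff.rfl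

theorem mem_AAC_iff {C : Set V} : C ∈ G.AAC ord X ↔
    G.IsAC (upTo ord X) X C ∧ (G.indepSet (upTo ord X) C).Nonempty := by
  rw [Set.nonempty_iff_ne_empty]; exact Iff.rfl

end Order

end CausalGraph

/-! ## FindAAC -/

namespace AdjLists

/-- The list that `activeMoves` returns. -/
def activeNbrs {V : Type} (A : AdjLists V) (Z anZ : V → Bool) (s : V × Bool) : List (V × Bool) :=
  let up := (A.pa s.1).map (fun u => (u, false)) ++ (A.sp s.1).map (fun u => (u, true))
  let down := (A.ch s.1).map (fun u => (u, true))
  match s.2 with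
    | false => if Z s.1 then [] else up ++ down
    | true => (if anZ s.1 then up else []) ++ (if Z s.1 then [] else down)

namespace Stores

open Comp

variable {V : Type} {A : AdjLists V} {G : CausalGraph V} {S : Set V}

theorem mem_activeNbrs (hA : A.Stores G S) {Z anZ : V → Bool}
    (hZ : ∀ v, anZ v = true ↔ v ∈ G.An {v | Z v = true}) (a b : V × Bool) :
    b ∈ A.activeNbrs Z anZ a ↔ G.ActiveStep S {v | Z v = true} a b := by
  obtain ⟨v, d⟩ := a
  obtain ⟨u, e⟩ := b
  unfold CausalGraph.ActiveStep activeNbrs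
  simp only [← hZ, Set.mem_ofPred_eq]
  cases d <;> cases e <;> cases Z v <;> cases anZ v <;>
    simp [hA.mem_pa, hA.mem_sp, hA.mem_ch] <;> tauto

theorem spec_activeMoves (A : AdjLists V) (Z anZ : V → Bool) (s : V × Bool) :
    Spec (A.activeMoves Z anZ s)
      (3 + ((A.pa s.1).length + (A.sp s.1).length + (A.ch s.1).length))
      (fun r => r = A.activeNbrs Z anZ s) := by
  refine ((spec_getBit Z s.1).bind fun b hb => (spec_getBit anZ s.1).bind fun c hc =>
    (spec_charge _).bind (b := 0) fun _ _ => spec_pure ?_).le ?_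
  · subst hb hc
    rfl
  · simp
    omega

theorem length_activeNbrs_le (A : AdjLists V) (Z anZ : V → Bool) (s : V × Bool) :
    (A.activeNbrs Z anZ s).length ≤
      (A.pa s.1).length + (A.sp s.1).length + (A.ch s.1).length := by
  obtain ⟨v, d⟩ := s
  unfold activeNbrs
  cases d <;> cases Z v <;> cases anZ v <;> simp <;> omega

variable [Fintype V] [DecidableEq V]

theorem spec_testSep (hA : A.Stores G S) (hS : G.IsAncestral S) (X D : V) {Z : V → Bool}
    (hZ : {v | Z v = true} ⊆ S) :
    Spec (A.testSep X D Z) (35 * G.size)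
      (fun r => r = true ↔ G.Separates S {v | Z v = true} X D) := by
  refine ((hA.spec_anSet hS hZ).bind (b := 18 * G.size + (1 + (1 + 0))) fun anZ hanZ => ?_).le
    (by unfold CausalGraph.size; omega)
  refine Spec.bind (P := fun vis => ∀ v, vis v = true ↔
      Relation.ReflTransGen (G.ActiveStep S {v | Z v = true}) (X, false) v) ?_ fun vis hvis => ?_
  · refine (spec_reach (spec_activeMoves A Z anZ) [(X, false)]).mono ?_ fun vis hvis v => ?_
    · have h1 : ∀ s : V × Bool,
          1 + (3 + ((A.pa s.1).length + (A.sp s.1).length + (A.ch s.1).length) +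
            3 * (A.activeNbrs Z anZ s).length) ≤
          4 + 4 * ((A.pa s.1).length + (A.sp s.1).length + (A.ch s.1).length) := fun s => by
        have := length_activeNbrs_le A Z anZ s
        omega
      have h2 := Finset.sum_le_sum fun s (_ : s ∈ Finset.univ) => h1 s
      -- Each node gives two search states, one per kind of edge end, which doubles the node and
      -- degree sums.
      have h3 : ∑ s : V × Bool,
          (4 + 4 * ((A.pa s.1).length + (A.sp s.1).length + (A.ch s.1).length)) =
          8 * Fintype.card V +
            8 * ∑ v, ((A.pa v).length + (A.sp v).length + (A.ch v).length) := by
        rw [Fintype.sum_prod_type]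
        simp only [Finset.sum_const, Finset.card_univ, Fintype.card_bool, smul_eq_mul, mul_add,
          Finset.sum_add_distrib, ← Finset.mul_sum]
        ring
      have h4 := hA.sum_degrees_le
      rw [Fintype.card_prod, Fintype.card_bool, List.length_singleton]
      unfold CausalGraph.size
      omega
    · rw [hvis]
      have : (fun a b => b ∈ A.activeNbrs Z anZ a) = G.ActiveStep S {v | Z v = true} := by
        funext a b
        exact propext (hA.mem_activeNbrs hanZ a b)
      simp [this]
  · refine (spec_getBit vis _).bind fun b hb => (spec_getBit vis _).bind fun c hc => spec_pure ?_
    subst hb hc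
    unfold CausalGraph.Separates
    simp [← hvis]

/-- The candidate that `findSeparator` tests. -/
def _root_.CausalGraph.candidate {V : Type} (G : CausalGraph V) (X D : V) (P Q : Set V) : Set V :=
  G.An ({X, D} ∪ P) ∩ (Q \ {X, D})

theorem spec_findSeparator (hA : A.Stores G S) (hS : G.IsAncestral S) {X D : V} (hX : X ∈ S)
    (hD : D ∈ S) {P Q : V → Bool} (hP : {v | P v = true} ⊆ S) (hQ : {v | Q v = true} ⊆ S) :
    Spec (A.findSeparator X D P Q) (70 * G.size) (fun r =>
      (∀ Z, r = some Z →
        {v | Z v = true} = G.candidate X D {v | P v = true} {v | Q v = true} ∧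
        G.Separates S (G.candidate X D {v | P v = true} {v | Q v = true}) X D) ∧
      (r = none →
        ¬ G.Separates S (G.candidate X D {v | P v = true} {v | Q v = true}) X D)) := by
  refine (spec_newArray.bind fun a ha => (spec_setBits a [X, D]).bind fun XD hXD =>
    (hA.spec_unionSet XD P).bind fun U hU =>
    (hA.spec_anSet hS fun v hv => ((hU v).1 hv).1).bind fun N hN =>
    (hA.spec_select_verts (c := 2) (q := fun v => Q v && N v) fun v =>
      (spec_getBit Q v).bind (b := 1) fun _ h => (spec_getBit N v).bind (b := 0)
        fun _ h' => spec_pure (by rw [h, h'])).bind fun QN hQN =>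
    (hA.spec_diffSet QN XD).bind (b := 35 * G.size + 0) fun Z hZ => ?_).le ?_
  · have hXD' : ∀ v, XD v = true ↔ v ∈ ({X, D} : Set V) := fun v => by simp [hXD, ha]
    have hUset : {v | U v = true} = {X, D} ∪ {v | P v = true} := by
      ext v
      simp only [Set.mem_ofPred_eq, hU, Set.mem_union, hXD']
      refine ⟨And.right, fun h => ⟨?_, h⟩⟩
      rcases h with (rfl | h) | h
      · exact hX
      · rwa [Set.mem_singleton_iff.1 h]
      · exact hP h
    have hZset : {v | Z v = true} = G.candidate X D {v | P v = true} {v | Q v = true} := by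
      ext v
      unfold CausalGraph.candidate
      rw [← hUset]
      simp only [Set.mem_ofPred_eq, hZ, hQN, Bool.and_eq_true, hN, hXD', Set.mem_inter_iff,
        Set.mem_sdiff]
      refine ⟨fun ⟨_, ⟨_, h1, h2⟩, h3⟩ => ⟨h2, h1, h3⟩, fun ⟨h2, h1, h3⟩ =>
        ⟨hQ h1, ⟨hQ h1, h1, h2⟩, h3⟩⟩
    have hZS : {v | Z v = true} ⊆ S := fun v hv => ((hZ v).1 hv).1
    refine (hA.spec_testSep hS X D hZS).bind fun t ht => ?_
    rw [hZset] at ht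
    cases t
    · refine spec_pure ⟨by simp, fun _ h => ?_⟩
      simpa using ht.2 h
    · refine spec_pure ⟨fun Z' hZ' => ?_, by simp⟩
      obtain rfl : Z = Z' := by simpa using hZ'
      exact ⟨hZset, ht.1 rfl⟩
  · simp only [List.length_cons, List.length_nil]
    unfold CausalGraph.size
    omega

theorem spec_blockedSet (hA : A.Stores G S) (hS : G.IsAncestral S) {C : V → Bool}
    (hC : {v | C v = true} ⊆ S) :
    Spec (A.blockedSet C) (28 * G.size) (fun r => ∀ v, r v = true ↔
      v ∈ S ∧ v ∈ G.De (G.Spo {v | C v = true} \ G.Pa {v | C v = true})) := by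
  refine ((hA.spec_spSet hC).bind fun s hs => (hA.spec_paSet hS hC).bind fun p hp =>
    (hA.spec_diffSet s p).bind (b := 15 * G.size) fun d hd =>
    (hA.spec_deSet hS fun v hv => ((hd v).1 hv).1).mono le_rfl fun r hr v => ?_).le (by omega)
  rw [hr]
  refine and_congr_right fun hv => ⟨?_, ?_⟩
  · rintro ⟨u, hu, huv⟩
    have := (hd u).1 hu
    rw [hs, hp] at this
    exact ⟨u, ⟨this.2.1.2, this.2.2⟩, huv⟩
  · rintro ⟨u, hu, huv⟩
    -- Spouses are computed only within `S`, but a node with a directed path to `v ∈ S` is in `S`,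
    -- so none that matters is missed.
    have huS := hS.mem_of_reach huv hv
    refine ⟨u, (hd u).2 ?_, huv⟩
    rw [hs, hp]
    exact ⟨huS, ⟨huS, hu.1⟩, hu.2⟩

theorem spec_indepSide (hA : A.Stores G S) (hS : G.IsAncestral S) {C : V → Bool}
    (hC : {v | C v = true} ⊆ S) :
    Spec (A.indepSide C) (35 * G.size)
      (fun r => r.length ≤ Fintype.card V ∧
        ∀ v, v ∈ r ↔ v ∈ G.indepSet S {v | C v = true}) := by
  refine ((hA.spec_blockedSet hS hC).bind fun b hb => (hA.spec_paSet hS hC).bind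
    (b := 3 * G.size) fun p hp =>
    (hA.spec_filter_verts (c := 2) (q := fun v => !b v && !p v) fun v =>
      (spec_getBit b v).bind (b := 1) fun _ h => (spec_getBit p v).bind (b := 0)
        fun _ h' => spec_pure (by rw [h, h'])).mono le_rfl fun r hr => ?_).le (by omega)
  subst hr
  refine ⟨(List.length_filter_le _ _).trans hA.verts_length_le, fun v => ?_⟩
  unfold CausalGraph.indepSet
  rw [List.mem_filter, hA.mem_verts, Set.mem_sdiff, Set.mem_sdiff, ← hp, Bool.and_eq_true,
    Bool.not_eq_true', Bool.not_eq_true', Bool.not_eq_true, ← Bool.not_eq_true, hb]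
  tauto

theorem spec_isAdmissible (hA : A.Stores G S) (hS : G.IsAncestral S) {C : V → Bool}
    (hC : {v | C v = true} ⊆ S) :
    Spec (A.isAdmissible C) (35 * G.size)
      (fun r => r = true ↔ (G.indepSet S {v | C v = true}).Nonempty) := by
  refine (hA.spec_indepSide hS hC).bind (b := 0) fun W hW => spec_pure ?_
  rw [Bool.not_eq_true', ← Bool.not_eq_true, List.isEmpty_iff,
    List.eq_nil_iff_forall_not_mem, not_forall_not]
  simp only [hW.2]
  exact Iff.rfl

theorem spec_findAACLoop (hA : A.Stores G S) (hS : G.IsAncestral S) {X : V} (hX : X ∈ S)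
    {I P Q : V → Bool} (hI : {v | I v = true} ⊆ S) (hP : {v | P v = true} ⊆ S)
    (hQ : {v | Q v = true} ⊆ S) (Ds : List V) (hDs : ∀ D ∈ Ds, D ∈ S) :
    Spec (A.findAACLoop X I P Q Ds) ((Ds.length + 1) * (120 * G.size)) (fun r =>
      (∀ C, r = some C → ∃ D ∈ Ds,
        {v | C v = true} = G.cComponent (G.An ({v | I v = true} ∪
          G.candidate X D {v | P v = true} {v | Q v = true})) X ∧
        G.Separates S (G.candidate X D {v | P v = true} {v | Q v = true}) X D) ∧
      (r = none → ∀ D ∈ Ds,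
        ¬ G.Separates S (G.candidate X D {v | P v = true} {v | Q v = true}) X D)) := by
  have hsize : 1 ≤ G.size := by unfold CausalGraph.size; omega
  induction Ds with
  | nil =>
    exact ((spec_charge 1).bind (b := 0) fun _ _ => spec_pure (by simp)).le (by simp; omega)
  | cons D Ds ih =>
    have hDS := hDs D (by simp)
    have hcand : G.candidate X D {v | P v = true} {v | Q v = true} ⊆ S :=
      Set.inter_subset_right.trans (Set.sdiff_subset.trans hQ)
    refine ((spec_charge 1).bind fun _ _ => (hA.spec_findSeparator hS hX hDS hP hQ).bind
      -- The first term pays for the recursive call, the second for the returning branch: `46 = 5 +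
      -- 15 + 17 + 9` for union, ancestors, induced subgraph and component.
      (b := (Ds.length + 1) * (120 * G.size) + 46 * G.size) fun r hr => ?_).le ?_
    · cases r with
      | none =>
        refine (ih fun D hD => hDs D (by simp [hD])).mono (by omega) fun r' hr' => ⟨?_, ?_⟩
        · intro C hC
          obtain ⟨D', hD', h⟩ := hr'.1 C hC
          exact ⟨D', by simp [hD'], h⟩
        · intro h D' hD'
          rcases List.mem_cons.1 hD' with rfl | hD'
          · exact hr.2 rfl
          · exact hr'.2 h D' hD'
      | some Z =>
        obtain ⟨hZ, hsep⟩ := hr.1 Z rfl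
        have hUset : ∀ U : V → Bool, (∀ v, U v = true ↔ v ∈ S ∧ (I v = true ∨ Z v = true)) →
            {v | U v = true} = {v | I v = true} ∪
              G.candidate X D {v | P v = true} {v | Q v = true} := by
          intro U hU
          rw [← hZ]
          ext v
          rw [Set.mem_ofPred_eq, hU]
          refine ⟨And.right, fun h => ⟨?_, h⟩⟩
          rcases h with h | h
          · exact hI h
          · rw [hZ] at h; exact hcand h
        refine ((hA.spec_unionSet I Z).bind fun U hU => (hA.spec_anSet hS (C := U) ?_).bind
          fun N hN => (hA.spec_induce N).bind fun A' hA' => (hA'.spec_cComp X).bind (b := 0)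
          fun C hC => spec_pure ⟨?_, by simp⟩).le (by omega)
        · exact fun v hv => ((hU v).1 hv).1
        · intro C' hC'
          obtain rfl : C = C' := by simpa using hC'
          refine ⟨D, by simp, ?_, hsep⟩
          have hN' : {v | N v = true} = G.An ({v | I v = true} ∪
              G.candidate X D {v | P v = true} {v | Q v = true}) := by
            rw [← hUset U hU]; exact Set.ext hN
          have hsub : {v | N v = true} ⊆ S := by
            rw [hN']
            exact hS.An_subset (Set.union_subset hI hcand)
          rw [← hN', ← Set.inter_eq_right.2 hsub]
          exact Set.ext hC
    · rw [List.length_cons]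
      have : (Ds.length + 1 + 1) * (120 * G.size) =
        (Ds.length + 1) * (120 * G.size) + 120 * G.size := by ring
      omega

/-- FindAAC returns an admissible ancestral c-component between `I` and `R` if there is one. -/
theorem spec_findAAC (hA : A.Stores G S) (hS : G.IsAncestral S) {X : V}
    (hsink : ∀ v ∈ S, ¬ G.dir X v) {I R : V → Bool} (hI : G.IsAC S X {v | I v = true})
    (hR : G.IsAC S X {v | R v = true}) (hIR : {v | I v = true} ⊆ {v | R v = true}) :
    Spec (A.findAAC X I R) (Fintype.card V * (240 * G.size)) (fun r =>
      (∀ C, r = some C → G.IsAC S X {v | C v = true} ∧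
        (G.indepSet S {v | C v = true}).Nonempty ∧
        {v | I v = true} ⊆ {v | C v = true} ∧ {v | C v = true} ⊆ {v | R v = true}) ∧
      (r = none → ¬ ∃ C, G.IsAC S X C ∧ (G.indepSet S C).Nonempty ∧
        {v | I v = true} ⊆ C ∧ C ⊆ {v | R v = true})) := by
  have hcard : 1 ≤ Fintype.card V := Fintype.card_pos_iff.2 ⟨X⟩
  have hXI : X ∈ {v | I v = true} := hI.self_mem
  have hXS : X ∈ S := hI.subset hXI
  refine ((hA.spec_isAdmissible hS hI.subset).bind
    (b := 28 * G.size + (4 * G.size + (4 * G.size + (2 * G.size +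
      (Fintype.card V) * (120 * G.size))))) fun b hb => ?_).le ?_
  · cases b
    · have hvac : G.indepSet S {v | I v = true} = ∅ := by
        rw [← Set.not_nonempty_iff_eq_empty, ← hb]; simp
      refine (hA.spec_blockedSet hS hI.subset).bind fun B hB =>
        (hA.spec_paSet hS hI.subset).bind fun P hP =>
        (hA.spec_paSet hS hR.subset).bind fun Q hQ =>
        (hA.spec_filter_verts (q := B) (c := 1) fun v => spec_getBit B v).bind fun Ds hDs => ?_
      have hPset : {v | P v = true} = G.Pa {v | I v = true} := Set.ext hP
      have hQset : {v | Q v = true} = G.Pa {v | R v = true} := Set.ext hQ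
      have hmemD : ∀ D, D ∈ Ds ↔ D ∈ S ∧
          D ∈ G.De (G.Spo {v | I v = true} \ G.Pa {v | I v = true}) := by
        intro D
        rw [hDs, hA.mem_filter_verts fun v hv => ((hB v).1 hv).1, hB]
      have hlen : Ds.length + 1 ≤ Fintype.card V := by
        -- the variable `X` itself is not a candidate
        have hnd : (X :: Ds).Nodup := by
          refine List.nodup_cons.2 ⟨fun h => ?_, hDs ▸ hA.verts_nodup.filter _⟩
          exact hI.not_mem_De (CausalGraph.subset_An _ (CausalGraph.subset_Pa _ hXI))
            ((hmemD X).1 h).2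
        simpa using hnd.length_le_card
      refine (hA.spec_findAACLoop hS hXS hI.subset (P := P) (Q := Q)
        (by rw [hPset]; exact hS.Pa_subset hI.subset)
        (by rw [hQset]; exact hS.Pa_subset hR.subset) Ds fun D hD => ((hmemD D).1 hD).1).mono
        (Nat.mul_le_mul_right _ hlen) fun r hr => ?_
      rw [hPset, hQset] at hr
      refine ⟨fun C hC => ?_, fun hnone => ?_⟩
      · obtain ⟨D, hD, hCset, hsep⟩ := hr.1 C hC
        rw [hmemD] at hD
        -- Since `D` is not in `Pa(I)`, deleting `X` and `D` from the candidate still leaves all of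
        -- `Pa(I) \ {X}` in it.
        have hDP : D ∉ G.An (G.Pa {v | I v = true}) := fun h => hI.not_mem_De h hD.2
        have hDI : D ∉ G.An {v | I v = true} := fun ⟨w, hw, h⟩ =>
          hDP ⟨w, CausalGraph.subset_Pa _ hw, h⟩
        obtain ⟨h1, h2, h3, h4⟩ := hsep.exists_indep hS hsink hI hR hIR
          (Z := G.candidate X D (G.Pa {v | I v = true}) (G.Pa {v | R v = true}))
          (fun v hv => ⟨CausalGraph.subset_An _ (Or.inr hv.1),
            CausalGraph.Pa_mono hIR hv.1, by
              rintro (h | h)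
              · exact hv.2 h
              · exact hDP (CausalGraph.subset_An _ (h ▸ hv.1))⟩)
          (fun v hv => hv.2.1) (fun h => h.2.2 (by simp)) hD.1 hDI
        rw [hCset]
        exact ⟨h1, ⟨D, h4⟩, h2, h3⟩
      · rintro ⟨C, hC, ⟨D, hD⟩, hIC, hCR⟩
        refine hr.2 hnone D ?_ (hC.separates hS hsink hIC hCR hD)
        refine (hmemD D).2 ⟨hD.1.1, ?_⟩
        -- `D` is outside `Pa(C)` and hence outside `Pa(I)`. If it were not blocked for `I`, it
        -- would make the relation of `I` non-vacuous, but that case has been dealt with.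
        by_contra hDI
        have : D ∈ G.indepSet S {v | I v = true} :=
          ⟨⟨hD.1.1, hDI⟩, fun h => hD.2 (CausalGraph.Pa_mono hIC h)⟩
        rw [hvac] at this
        exact this
    · refine (spec_pure ⟨fun C hC => ?_, by simp⟩).le (Nat.zero_le _)
      obtain rfl : I = C := by simpa using hC
      exact ⟨hI, hb.1 rfl, subset_rfl, hIR⟩
  · have : 1 * (120 * G.size) ≤ Fintype.card V * (120 * G.size) := Nat.mul_le_mul_right _ hcard
    have h2 : Fintype.card V * (240 * G.size) =
      Fintype.card V * (120 * G.size) + Fintype.card V * (120 * G.size) := by ring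
    omega

end Stores

end AdjLists

/-! ## Delay and enumeration -/

section Traces

open Comp

variable {O α β : Type}

/-- A trace without outputs. -/
def Silent (t : List (TraceEvent O)) : Prop := ∀ e ∈ t, e = TraceEvent.step

theorem silent_append {t u : List (TraceEvent O)} : Silent (t ++ u) ↔ Silent t ∧ Silent u :=
  List.forall_mem_append

/-- Bounds for the silent prefixes, suffixes and infixes of a trace. -/
structure GapBound (t : List (TraceEvent O)) (p s d : ℕ) : Prop where
  pre : ∀ l, l <+: t → Silent l → l.length ≤ p
  suf : ∀ l, l <:+ t → Silent l → l.length ≤ s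
  inf : ∀ l, l <:+: t → Silent l → l.length ≤ d

theorem gapBound_of_length_le {t : List (TraceEvent O)} {p s d : ℕ} (hp : t.length ≤ p)
    (hs : t.length ≤ s) (hd : t.length ≤ d) : GapBound t p s d :=
  ⟨fun _ h _ => h.length_le.trans hp, fun _ h _ => h.length_le.trans hs,
    fun _ h _ => h.length_le.trans hd⟩

theorem gapBound_output (o : O) (p s d : ℕ) : GapBound [TraceEvent.output o] p s d := by
  have key : ∀ l : List (TraceEvent O), l <:+: [TraceEvent.output o] → Silent l → l.length = 0 := by
    intro l hl hs
    cases l with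
    | nil => rfl
    | cons e l =>
      have h1 := hs e (by simp)
      have h2 := hl.subset (show e ∈ e :: l by simp)
      rw [List.mem_singleton, h1] at h2
      cases h2
  exact ⟨fun l h hs => by simp [key l h.isInfix hs], fun l h hs => by simp [key l h.isInfix hs],
    fun l h hs => by simp [key l h hs]⟩

theorem GapBound.mono {t : List (TraceEvent O)} {p s d p' s' d' : ℕ} (h : GapBound t p s d)
    (hp : p ≤ p') (hs : s ≤ s') (hd : d ≤ d') : GapBound t p' s' d' :=
  ⟨fun l hl hs' => (h.pre l hl hs').trans hp, fun l hl hs' => (h.suf l hl hs').trans hs,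
    fun l hl hs' => (h.inf l hl hs').trans hd⟩

/-- A silent prefix reaches past `t` only if all of `t` is silent, and dually for suffixes. An
interior silent stretch across the junction is a suffix of `t` followed by a prefix of `u`. -/
theorem GapBound.append {t u : List (TraceEvent O)} {p₁ s₁ p₂ s₂ p s d : ℕ}
    (ht : GapBound t p₁ s₁ d) (hu : GapBound u p₂ s₂ d) (hp : p₁ ≤ p)
    (hp' : Silent t → t.length + p₂ ≤ p) (hs : s₂ ≤ s) (hs' : Silent u → s₁ + u.length ≤ s)
    (hd : s₁ + p₂ ≤ d) : GapBound (t ++ u) p s d := by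
  refine ⟨fun l hl hsil => ?_, fun l hl hsil => ?_, fun l hl hsil => ?_⟩
  · rcases List.prefix_or_prefix_of_prefix hl (List.prefix_append t u) with h | ⟨l', rfl⟩
    · exact (ht.pre l h hsil).trans hp
    · have h := (List.prefix_append_right_inj t).1 hl
      obtain ⟨h1, h2⟩ := silent_append.1 hsil
      have := hu.pre l' h h2
      have := hp' h1
      rw [List.length_append]
      omega
  · rcases List.suffix_or_suffix_of_suffix hl (List.suffix_append t u) with h | ⟨l', rfl⟩
    · exact (hu.suf l h hsil).trans hs
    · obtain ⟨w, hw⟩ := hl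
      rw [← List.append_assoc] at hw
      have h : l' <:+ t := ⟨w, List.append_cancel_right hw⟩
      obtain ⟨h1, h2⟩ := silent_append.1 hsil
      have := ht.suf l' h h1
      have := hs' h2
      rw [List.length_append]
      omega
  · rcases List.infix_append_iff.1 hl with h | h | ⟨a, b, rfl, ha, hb⟩
    · exact ht.inf l h hsil
    · exact hu.inf l h hsil
    · obtain ⟨h1, h2⟩ := silent_append.1 hsil
      have := ht.suf a ha h1
      have := hu.pre b hb h2
      rw [List.length_append]
      omega

/-- The trace of `c` consists of at most `k` silent steps and a rest that satisfies `Q`. -/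
def Comp.Leads (c : Comp O α) (k : ℕ) (Q : List (TraceEvent O) → Prop) : Prop :=
  ∃ t u, c.trace = t ++ u ∧ Silent t ∧ t.length ≤ k ∧ Q u

theorem leads_trace {c : Comp O α} {Q : List (TraceEvent O) → Prop} (h : Q c.trace) :
    c.Leads 0 Q :=
  ⟨[], c.trace, rfl, by simp [Silent], by simp, h⟩

theorem Comp.Spec.leads {x : Comp O α} {f : α → Comp O β} {a b : ℕ} {P : α → Prop}
    {Q : List (TraceEvent O) → Prop} (hx : Spec x a P) (hf : ∀ v, P v → (f v).Leads b Q) :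
    (x >>= f).Leads (a + b) Q := by
  obtain ⟨t, u, h, ht, htb, hu⟩ := hf _ hx.val
  refine ⟨x.trace ++ t, u, ?_, silent_append.2 ⟨hx.1, ht⟩, ?_, hu⟩
  · rw [trace_bind, h, List.append_assoc]
  · have := hx.2.1
    rw [List.length_append]
    omega

theorem Comp.Leads.le {c : Comp O α} {a b : ℕ} {Q : List (TraceEvent O) → Prop}
    (h : c.Leads a Q) (hab : a ≤ b) : c.Leads b Q := by
  obtain ⟨t, u, h, ht, htb, hu⟩ := h
  exact ⟨t, u, h, ht, htb.trans hab, hu⟩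

variable {V : Type}

/-- The relations that are output in a trace. -/
def traceRels (t : List (TraceEvent (CIOutput V))) : List (CIRel V) :=
  (Comp.outputs (⟨t, ()⟩ : Prog V Unit)).map CIOutput.toRel

theorem traceRels_append (t u : List (TraceEvent (CIOutput V))) :
    traceRels (t ++ u) = traceRels t ++ traceRels u := by
  simp [traceRels, Comp.outputs]

theorem traceRels_output (o : CIOutput V) : traceRels [TraceEvent.output o] = [o.toRel] := rfl

theorem traceRels_of_silent {t : List (TraceEvent (CIOutput V))} (h : Silent t) :
    traceRels t = [] := by
  induction t with
  | nil => rfl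
  | cons e t ih =>
    have he := h e (by simp)
    subst he
    exact ih fun e he => h e (by simp [he])

/-- The trace outputs all the relations in `L` and only those, each exactly once. -/
def TraceEnumerates (t : List (TraceEvent (CIOutput V))) (L : Set (CIRel V)) : Prop :=
  (∀ r, r ∈ traceRels t ↔ r ∈ L) ∧ (traceRels t).Nodup

theorem TraceEnumerates.append {t u : List (TraceEvent (CIOutput V))} {L M : Set (CIRel V)}
    (ht : TraceEnumerates t L) (hu : TraceEnumerates u M) (h : Disjoint L M) :
    TraceEnumerates (t ++ u) (L ∪ M) := by
  refine ⟨fun r => ?_, ?_⟩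
  · rw [traceRels_append, List.mem_append, ht.1, hu.1, Set.mem_union]
  · rw [traceRels_append]
    refine ht.2.append hu.2 fun r h1 h2 => ?_
    exact Set.disjoint_left.1 h ((ht.1 r).1 h1) ((hu.1 r).1 h2)

theorem traceEnumerates_of_silent {t : List (TraceEvent (CIOutput V))} (h : Silent t) :
    TraceEnumerates t ∅ := by
  simp [TraceEnumerates, traceRels_of_silent h]

/-- Used in contrapositive form: a call that has something to list cannot be silent. -/
theorem TraceEnumerates.eq_empty {t : List (TraceEvent (CIOutput V))} {L : Set (CIRel V)}
    (ht : TraceEnumerates t L) (h : Silent t) : L = ∅ := by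
  ext r
  rw [← ht.1, traceRels_of_silent h]
  simp

theorem enumeratesExactly_of_trace {c : Prog V α} {L : Set (CIRel V)} {p s d : ℕ}
    (h : TraceEnumerates c.trace L) (hd : GapBound c.trace p s d) : EnumeratesExactly c L d :=
  ⟨h.1, h.2, fun l hl hs => hd.inf l hl hs⟩

end Traces

/-! ## ListCIX -/

namespace CausalGraph

variable {V : Type}

/-- The relation of `C` for `X` in the subgraph induced on `S`. -/
def relOf (G : CausalGraph V) (S : Set V) (X : V) (C : Set V) : CIRel V :=
  ⟨X, G.indepSet S C, G.Pa C \ {X}⟩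

/-- The relations of all admissible ancestral c-components between `I` and `R`. -/
def relsBetween (G : CausalGraph V) (S : Set V) (X : V) (I R : Set V) : Set (CIRel V) :=
  {r | ∃ C, G.IsAC S X C ∧ (G.indepSet S C).Nonempty ∧ I ⊆ C ∧ C ⊆ R ∧ r = G.relOf S X C}

variable {G : CausalGraph V} {S : Set V} {X s : V} {I R : Set V}

theorem relsBetween_nonempty_iff : (G.relsBetween S X I R).Nonempty ↔
    ∃ C, G.IsAC S X C ∧ (G.indepSet S C).Nonempty ∧ I ⊆ C ∧ C ⊆ R :=
  ⟨fun ⟨_, C, h1, h2, h3, h4, _⟩ => ⟨C, h1, h2, h3, h4⟩,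
    fun ⟨C, h1, h2, h3, h4⟩ => ⟨_, C, h1, h2, h3, h4, rfl⟩⟩

theorem relsBetween_self (hI : G.IsAC S X I) (h : (G.indepSet S I).Nonempty) :
    G.relsBetween S X I I = {G.relOf S X I} := by
  ext r
  constructor
  · rintro ⟨C, _, _, h1, h2, rfl⟩
    rw [h1.antisymm h2]
    rfl
  · rintro rfl
    exact ⟨I, hI, h, subset_rfl, subset_rfl, rfl⟩

/-- The case distinction is whether `s ∈ C`. If so, `C` contains the extended lower end; if not, `s`
is a spouse of `C` outside `C`, and `C` fits under the shrunken upper end. -/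
theorem relsBetween_split (hI : G.IsAC S X I) (hR : G.IsAC S X R) (hIR : I ⊆ R)
    (hsI : s ∈ G.Spo I) (hs : s ∉ I) (hsR : s ∈ R) :
    G.relsBetween S X I R =
      G.relsBetween S X I (G.cComponent (R \ G.De {s}) X) ∪
        G.relsBetween S X (G.cComponent (G.An (I ∪ {s})) X) R := by
  obtain ⟨_, hII', _⟩ := hI.extend hR hIR hsR
  obtain ⟨_, hR'⟩ := hI.shrink hR hIR hsI hs
  ext r
  constructor
  · rintro ⟨C, hC, hadm, hIC, hCR, rfl⟩
    by_cases hsC : s ∈ C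
    · exact Or.inr ⟨C, hC, hadm, hC.extend_subset hIC hsC, hCR, rfl⟩
    · obtain ⟨i, hi, hsi⟩ := hsI
      exact Or.inl ⟨C, hC, hadm, hIC, hC.subset_shrink ⟨i, hIC hi, hsi⟩ hsC hCR, rfl⟩
  · rintro (⟨C, hC, hadm, hIC, hCR, rfl⟩ | ⟨C, hC, hadm, hIC, hCR, rfl⟩)
    · exact ⟨C, hC, hadm, hIC, hCR.trans (hR'.trans Set.sdiff_subset), rfl⟩
    · exact ⟨C, hC, hadm, hII'.trans hIC, hCR, rfl⟩

/-- A common relation would come from a single `C`, which would contain `s` through its lower end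
and omit it through its upper end. -/
theorem relsBetween_disjoint (hI : G.IsAC S X I) (hR : G.IsAC S X R) (hIR : I ⊆ R)
    (hsI : s ∈ G.Spo I) (hs : s ∉ I) :
    Disjoint (G.relsBetween S X I (G.cComponent (R \ G.De {s}) X))
      (G.relsBetween S X (G.cComponent (G.An (I ∪ {s})) X) R) := by
  rw [Set.disjoint_left]
  rintro r ⟨C, hC, _, _, hCR, rfl⟩ ⟨C', hC', _, hIC', _, h⟩
  obtain rfl : C = C' := hC.eq_of_Pa_diff_eq hC' (congrArg CIRel.cond h)
  exact ((hI.shrink hR hIR hsI hs).2 (hCR (hIC' (hI.mem_extend hsI)))).2 rfl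

end CausalGraph

namespace AdjLists.Stores

open Comp

variable {V : Type} [Fintype V] [DecidableEq V] {A : AdjLists V} {G : CausalGraph V} {S : Set V}

theorem leads_outputCI (hA : A.Stores G S) (hS : G.IsAncestral S) (X : V) {C : V → Bool}
    (hC : {v | C v = true} ⊆ S) :
    (A.outputCI X C).Leads (45 * G.size)
      (fun t => ∃ o, t = [TraceEvent.output o] ∧ o.toRel = G.relOf S X {v | C v = true}) := by
  refine Leads.le ((hA.spec_indepSide hS hC).leads fun W hW => (hA.spec_paSet hS hC).leads
    fun P hP => (hA.spec_filter_verts (c := 1) (q := fun v => P v && v != X) fun v =>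
      (spec_getBit P v).bind (b := 0) fun _ h => spec_pure (by rw [h])).leads
    (b := 3 * G.size) fun Z hZ => ((spec_charge _).leads (b := 0) fun _ _ =>
      leads_trace ⟨_, rfl, ?_⟩).le ?_) (by omega)
  · have h1 := hW.1
    have h2 : Z.length ≤ Fintype.card V := by
      subst hZ
      exact (List.length_filter_le _ _).trans hA.verts_length_le
    unfold CausalGraph.size
    omega
  · subst hZ
    unfold CIOutput.toRel CausalGraph.relOf
    ext v
    · rfl
    · exact hW.2 v
    · simp only [Set.mem_ofPred_eq, List.mem_filter, hA.mem_verts, Bool.and_eq_true, hP, bne_iff_ne,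
        Set.mem_sdiff, Set.mem_singleton_iff]
      exact ⟨And.right, fun h => ⟨hS.Pa_subset hC h.1, h⟩⟩

/-- A bound for the steps of one call of ListCIX, without its recursive calls. -/
noncomputable def _root_.CausalGraph.localCost (G : CausalGraph V) : ℕ :=
  Fintype.card V * (400 * G.size)

/-- The three ways in which a call of ListCIX can end. -/
theorem leads_listCIX (hA : A.Stores G S) (hS : G.IsAncestral S) {X : V}
    (hsink : ∀ v ∈ S, ¬ G.dir X v) {I R : V → Bool} (hI : G.IsAC S X {v | I v = true})
    (hR : G.IsAC S X {v | R v = true}) (hIR : {v | I v = true} ⊆ {v | R v = true})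
    (pick : V → (V → Bool) → (V → Bool) → List V → V)
    (hpick : ∀ X I R T, T ≠ [] → pick X I R T ∈ T) (k : ℕ) :
    (A.listCIX pick X (k + 1) I R).Leads G.localCost fun t =>
      (t = [] ∧ G.relsBetween S X {v | I v = true} {v | R v = true} = ∅) ∨
      ((G.relsBetween S X {v | I v = true} {v | R v = true}).Nonempty ∧
        {v | I v = true} = {v | R v = true} ∧
        ∃ o, t = [TraceEvent.output o] ∧ o.toRel = G.relOf S X {v | I v = true}) ∨
      ((G.relsBetween S X {v | I v = true} {v | R v = true}).Nonempty ∧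
        ∃ s I' R', R s = true ∧ I s ≠ true ∧ s ∈ G.Spo {v | I v = true} ∧
          {v | I' v = true} = G.cComponent (G.An ({v | I v = true} ∪ {s})) X ∧
          {v | R' v = true} = G.cComponent ({v | R v = true} \ G.De {s}) X ∧
          t = (A.listCIX pick X k I R').trace ++
            ((A.listCIX pick X k I' R).trace ++ [TraceEvent.step])) := by
  have hcard : 1 ≤ Fintype.card V := Fintype.card_pos_iff.2 ⟨X⟩
  have hIS := hI.subset
  refine Leads.le ((spec_charge 1).leads fun _ _ =>
    (hA.spec_findAAC hS hsink hI hR hIR).leads (b := 150 * G.size) fun r hr => ?_) ?_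
  · cases r with
    | none =>
      refine (leads_trace (Or.inl ⟨rfl, ?_⟩)).le (Nat.zero_le _)
      rw [← Set.not_nonempty_iff_eq_empty, CausalGraph.relsBetween_nonempty_iff]
      exact hr.2 rfl
    | some C₀ =>
      have hne : (G.relsBetween S X {v | I v = true} {v | R v = true}).Nonempty :=
        CausalGraph.relsBetween_nonempty_iff.2 ⟨_, hr.1 C₀ rfl⟩
      refine Leads.le ((hA.spec_eqSet I R).leads (b := 147 * G.size) fun b hb => ?_) (by omega)
      cases b
      · have hneq : ¬ {v | R v = true} ⊆ {v | I v = true} := by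
          intro h
          refine absurd (hb.2 fun v _ => ?_) (by simp)
          rw [Bool.eq_iff_iff]
          exact ⟨fun h' => hIR h', fun h' => h h'⟩
        refine Leads.le ((hA.spec_spSet hIS).leads fun spI hspI =>
          (hA.spec_filter_verts (c := 3) (q := fun v => R v && spI v && !I v) fun v =>
            (spec_getBit R v).bind (b := 2) fun _ h => (spec_getBit spI v).bind (b := 1)
              fun _ h' => (spec_getBit I v).bind (b := 0) fun _ h'' =>
                spec_pure (by rw [h, h', h''])).leads (b := 131 * G.size) fun T hT => ?_) (by omega)
        have hmemT : ∀ v, v ∈ T ↔ R v = true ∧ v ∈ G.Spo {v | I v = true} ∧ I v ≠ true := by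
          intro v
          subst hT
          simp only [List.mem_filter, hA.mem_verts, Bool.and_eq_true, hspI, Bool.not_eq_true',
            Bool.not_eq_true, ne_eq]
          have hRS := hR.subset
          constructor
          · rintro ⟨_, ⟨h1, _, h2⟩, h3⟩
            exact ⟨h1, h2, h3⟩
          · rintro ⟨h1, h2, h3⟩
            exact ⟨hRS h1, ⟨h1, hRS h1, h2⟩, h3⟩
        have hTlen : T.length ≤ Fintype.card V := by
          subst hT
          exact (List.length_filter_le _ _).trans hA.verts_length_le
        refine Leads.le ((spec_charge (1 + T.length)).leads (b := 130 * G.size) fun _ _ => ?_)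
          (by unfold CausalGraph.size; omega)
        clear hT hTlen
        cases T with
        | nil =>
          -- This branch is impossible: `I ≠ R`, so a spouse to split at exists.
          obtain ⟨s, hsR, hsI, hs⟩ := hI.exists_Spo hR hneq
          exact absurd ((hmemT s).2 ⟨hsR, hsI, hs⟩) (by simp)
        | cons t ts =>
          have hs := (hmemT _).1 (hpick X I R (t :: ts) (by simp))
          change Comp.Leads (newArray V >>= _) _ _
          -- From here only the membership of the chosen node in `T` matters.
          generalize pick X I R (t :: ts) = s at hs ⊢
          obtain ⟨hsR, hsI, hs⟩ := hs
          have hone' : ∀ a one : V → Bool, (∀ v, a v = false) →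
              (∀ v, one v = true ↔ a v = true ∨ v ∈ [s]) → {v | one v = true} = {s} := by
            intro a one ha hone
            ext v
            simp [hone, ha]
          have hsS : s ∈ S := hR.subset hsR
          refine Leads.le (spec_newArray.leads fun a ha => (spec_setBits a [s]).leads
            fun one hone => (hA.spec_unionSet I one).leads
            fun U hU => (hA.spec_anSet hS (fun v hv => ((hU v).1 hv).1)).leads
            fun N hN => (hA.spec_induce N).leads fun A₁ hA₁ => (hA₁.spec_cComp X).leads
            fun I' hI' => (hA.spec_deSet hS (by rw [hone' a one ha hone]; simpa using hsS)).leads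
            fun D hD => (hA.spec_diffSet R D).leads fun M hM => (hA.spec_induce M).leads
            fun A₂ hA₂ => (hA₂.spec_cComp X).leads (b := 0) fun R' hR' =>
            leads_trace (Or.inr (Or.inr ⟨hne, s, I', R', hsR, hs, hsI, ?_, ?_, rfl⟩))) ?_
          · have hUset : {v | U v = true} = {v | I v = true} ∪ {s} := by
              rw [← hone' a one ha hone]
              ext v
              rw [Set.mem_ofPred_eq, hU]
              refine ⟨And.right, fun h => ⟨?_, h⟩⟩
              rcases h with h | h
              · exact hIS h
              · rw [hone' a one ha hone] at h
                rwa [Set.mem_singleton_iff.1 h]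
            have hNset : {v | N v = true} = G.An ({v | I v = true} ∪ {s}) := by
              rw [← hUset]; exact Set.ext hN
            have hNS : {v | N v = true} ⊆ S := by
              rw [hNset, ← hUset]
              exact hS.An_subset fun v hv => ((hU v).1 hv).1
            rw [← hNset, ← Set.inter_eq_right.2 hNS]
            exact Set.ext hI'
          · have hMset : S ∩ {v | M v = true} = {v | R v = true} \ G.De {s} := by
              rw [← hone' a one ha hone]
              ext v
              rw [Set.mem_inter_iff, Set.mem_ofPred_eq, hM, hD]
              have hRS := hR.subset
              constructor
              · rintro ⟨h1, _, h2, h3⟩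
                exact ⟨h2, fun h => h3 ⟨h1, h⟩⟩
              · rintro ⟨h1, h2⟩
                exact ⟨hRS h1, hRS h1, h1, fun h => h2 h.2⟩
            rw [← hMset]
            exact Set.ext hR'
          · simp only [List.length_cons, List.length_nil]
            unfold CausalGraph.size
            omega
      · have hIReq : {v | I v = true} = {v | R v = true} := by
          refine hIR.antisymm fun v hv => ?_
          have := hb.1 rfl v (hR.subset hv)
          simpa [this] using hv
        have ⟨t, u, h1, h2, h3, h4⟩ := hA.leads_outputCI hS X hIS
        exact ⟨t, u, h1, h2, h3.trans (by omega), Or.inr (Or.inl ⟨hne, hIReq, h4⟩)⟩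
  · have hsize : 1 ≤ G.size := by unfold CausalGraph.size; omega
    unfold CausalGraph.localCost
    have h1 : 1 * (151 * G.size) ≤ Fintype.card V * (151 * G.size) := Nat.mul_le_mul_right _ hcard
    have h2 : Fintype.card V * (400 * G.size) = Fintype.card V * (240 * G.size) +
      Fintype.card V * (151 * G.size) + Fintype.card V * (9 * G.size) := by ring
    omega

end AdjLists.Stores

/-! ## Correctness and delay of ListCIX -/

namespace AdjLists.Stores

open Comp

variable {V : Type} [Fintype V] [DecidableEq V] {A : AdjLists V} {G : CausalGraph V} {S : Set V}

/-- Induction on the recursion cap `k`; `r` bounds the size of `R \ I`, and `r < k` ensures that the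
cap is never hit. The last conjunct drives the delay bound: a call without output has failed at
FindAAC, so it made no recursive calls and cost only `localCost`. -/
theorem trace_listCIX (hA : A.Stores G S) (hS : G.IsAncestral S) {X : V}
    (hsink : ∀ v ∈ S, ¬ G.dir X v)
    (pick : V → (V → Bool) → (V → Bool) → List V → V)
    (hpick : ∀ X I R T, T ≠ [] → pick X I R T ∈ T) (d k : ℕ) :
    ∀ r < k, 2 * ((2 * r + 1) * (G.localCost + 1)) ≤ d → ∀ I R : V → Bool,
      G.IsAC S X {v | I v = true} → G.IsAC S X {v | R v = true} →
      {v | I v = true} ⊆ {v | R v = true} → ({v | R v = true} \ {v | I v = true}).ncard ≤ r →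
      TraceEnumerates (A.listCIX pick X k I R).trace
        (G.relsBetween S X {v | I v = true} {v | R v = true}) ∧
      GapBound (A.listCIX pick X k I R).trace
        ((2 * r + 1) * (G.localCost + 1)) ((2 * r + 1) * (G.localCost + 1)) d ∧
      (Silent (A.listCIX pick X k I R).trace →
        (A.listCIX pick X k I R).trace.length ≤ G.localCost) := by
  induction k with
  | zero => intro r hr; omega
  | succ k ih =>
    intro r hr hd I R hI hR hIR hcard
    obtain ⟨t, u, htrace, ht, htk, h⟩ :=
      hA.leads_listCIX hS hsink hI hR hIR pick hpick k
    rw [htrace]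
    generalize hF : G.localCost = F at *
    have hg : F + 1 ≤ (2 * r + 1) * (F + 1) := Nat.le_mul_of_pos_left _ (by omega)
    rcases h with ⟨rfl, hempty⟩ | ⟨hne, hIReq, o, rfl, ho⟩ |
      ⟨hne, s, I', R', hsR, hsI, hsp, hI', hR', rfl⟩
    · rw [List.append_nil, hempty]
      exact ⟨traceEnumerates_of_silent ht,
        gapBound_of_length_le (by omega) (by omega) (by omega), fun _ => htk⟩
    · have hnsil : ¬ Silent [TraceEvent.output o] := by
        intro h
        have := h (TraceEvent.output o) (by simp)
        cases this
      refine ⟨?_, ?_, fun h => absurd (silent_append.1 h).2 hnsil⟩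
      · have hadm := CausalGraph.relsBetween_nonempty_iff.1 hne
        rw [← hIReq] at hadm ⊢
        obtain ⟨C, _, hadm, h1, h2⟩ := hadm
        rw [← h1.antisymm h2] at hadm
        rw [CausalGraph.relsBetween_self hI hadm, ← Set.empty_union {_}]
        refine (traceEnumerates_of_silent ht).append ⟨fun r => ?_, ?_⟩ (Set.empty_disjoint _)
        · rw [traceRels_output, ho]; simp
        · rw [traceRels_output]; simp
      · exact (gapBound_of_length_le (p := F) (s := F) htk htk (by omega)).append
          (gapBound_output o 0 0 d) (by omega) (by omega) (by omega)
          (fun h => absurd h hnsil) (by omega)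
    · have hr1 : 1 ≤ r :=
        le_trans ((Set.ncard_pos (s := {v | R v = true} \ {v | I v = true})).2 ⟨s, hsR, hsI⟩) hcard
      obtain ⟨r, rfl⟩ : ∃ q, r = q + 1 := ⟨r - 1, by omega⟩
      obtain ⟨e1, e2, e3⟩ := hI.extend hR hIR hsR
      have e4 := hI.mem_extend hsp
      obtain ⟨f1, f2⟩ := hI.shrink hR hIR hsp hsI
      have f3 := hI.subset_shrink hsp hsI hIR
      -- Both subintervals lose `s`: it is not in the new upper end, or it is in the new lower end.
      have hlt : ∀ B : Set V, B ⊆ ({v | R v = true} \ {v | I v = true}) \ {s} → B.ncard ≤ r := by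
        intro B hB
        have h1 := Set.ncard_le_ncard hB
        have h2 := Set.ncard_sdiff_singleton_add_one
          (show s ∈ {v | R v = true} \ {v | I v = true} from ⟨hsR, hsI⟩)
        omega
      -- The increment `2F + 2` per level pays for the work of the call itself, for one failing
      -- child and for the final step; the other child contributes its own bound for `r`.
      have hgr : (2 * (r + 1) + 1) * (F + 1) = (2 * r + 1) * (F + 1) + 2 * F + 2 := by ring
      have hg' : F + 1 ≤ (2 * r + 1) * (F + 1) := Nat.le_mul_of_pos_left _ (by omega)
      obtain ⟨a1, a2, a3⟩ := ih r (by omega) (by omega) I R' hI (by rw [hR']; exact f1)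
        (by rw [hR']; exact f3) (hlt _ (by
          rw [hR']
          exact fun v hv => ⟨⟨(f2 hv.1).1, hv.2⟩, (f2 hv.1).2⟩))
      obtain ⟨b1, b2, b3⟩ := ih r (by omega) (by omega) I' R (by rw [hI']; exact e1) hR
        (by rw [hI']; exact e3) (hlt _ (by
          rw [hI']
          refine fun v hv => ⟨⟨hv.1, fun h => hv.2 (e2 h)⟩, ?_⟩
          rintro rfl
          exact hv.2 e4))
      rw [hR'] at a1
      rw [hI'] at b1
      have hstep : Silent [(TraceEvent.step : TraceEvent (CIOutput V))] := by simp [Silent]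
      generalize (A.listCIX pick X k I R').trace = a at *
      generalize (A.listCIX pick X k I' R).trace = b at *
      generalize (2 * r + 1) * (F + 1) = g at *
      have henum : TraceEnumerates (t ++ (a ++ (b ++ [TraceEvent.step])))
          (G.relsBetween S X {v | I v = true} {v | R v = true}) := by
        rw [CausalGraph.relsBetween_split hI hR hIR hsp hsI hsR]
        have h := (traceEnumerates_of_silent ht).append
          (a1.append (b1.append (traceEnumerates_of_silent hstep) (Set.disjoint_empty _))
            (by rw [Set.union_empty]; exact CausalGraph.relsBetween_disjoint hI hR hIR hsp hsI))
          (Set.empty_disjoint _)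
        rwa [Set.union_empty, Set.empty_union] at h
      -- FindAAC succeeded, so there is a relation to list and the trace is not silent.
      refine ⟨henum, ?_, fun h => absurd (henum.eq_empty h) hne.ne_empty⟩
      have hta : GapBound (t ++ a) (F + g) (F + g) d :=
        (gapBound_of_length_le (p := F) (s := F) htk htk (by omega)).append a2 (by omega)
          (fun _ => by omega) (by omega) (fun h => by have := a3 h; omega) (by omega)
      have hbs : GapBound (b ++ [TraceEvent.step]) g (g + 1) d :=
        b2.append (gapBound_of_length_le (p := 1) (s := 1) (by simp) (by simp)
          (by simp; omega)) le_rfl (fun h => by have := b3 h; omega) (by omega)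
          (fun _ => by simp) (by omega)
      rw [← List.append_assoc]
      refine hta.append hbs (by omega) (fun h => ?_) (by omega) (fun h => ?_) (by omega)
      · have := a3 (silent_append.1 h).2
        rw [List.length_append]
        omega
      · have := b3 (silent_append.1 h).1
        rw [List.length_append, List.length_singleton]
        omega

end AdjLists.Stores

/-! ## Correctness and delay of ListCI -/

theorem mem_upTo_iff {V : Type} [DecidableEq V] {pre suf : List V} {X : V}
    (h : (pre ++ X :: suf).Nodup) (v : V) :
    v ∈ upTo (pre ++ X :: suf) X ↔ v ∈ pre ∨ v = X := by
  have hX : X ∉ pre := fun hX => (List.disjoint_of_nodup_append h) hX (by simp)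
  have hidx : (pre ++ X :: suf).idxOf X = pre.length := by
    rw [List.idxOf_append_of_notMem hX]; simp
  change (pre ++ X :: suf).idxOf v ≤ (pre ++ X :: suf).idxOf X ↔ _
  rw [hidx]
  by_cases hv : v ∈ pre
  · rw [List.idxOf_append_of_mem hv]
    simp [hv, (List.idxOf_lt_length_of_mem hv).le]
  · rw [List.idxOf_append_of_notMem hv]
    by_cases hvX : v = X
    · simp [hvX]
    · rw [List.idxOf_cons_ne _ (Ne.symm hvX)]
      simp [hv, hvX]

namespace AdjLists

open Comp

variable {V : Type} [Fintype V] [DecidableEq V] {A : AdjLists V} {G : CausalGraph V}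

/-- The body of the loop of `listCI`. -/
def listCIBody (pick : V → (V → Bool) → (V → Bool) → List V → V) (depth : ℕ) (A : AdjLists V)
    (U : V → Bool) (X : V) : Prog V (V → Bool) := do
  let U' ← setBit U X
  let N ← A.anSet (← setBits (← newArray V) [X])
  let I ← (← A.induce N).cComp X
  let AX ← A.induce U'
  let R ← AX.cComp X
  AX.listCIX pick X depth I R
  return U'

/-- The bound on the gaps of one call of `listCIX`. -/
noncomputable def _root_.CausalGraph.gapCost (G : CausalGraph V) : ℕ :=
  (2 * Fintype.card V + 1) * (G.localCost + 1)

theorem trace_listCIBody {ord : List V} (hord : G.IsConsistentOrder ord)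
    (hA : A.Stores G Set.univ) (pick : V → (V → Bool) → (V → Bool) → List V → V)
    (hpick : ∀ X I R T, T ≠ [] → pick X I R T ∈ T) {depth : ℕ} (hdepth : Fintype.card V ≤ depth)
    (X : V) (U : V → Bool) (hU : ∀ v, U v = true ∨ v = X ↔ v ∈ upTo ord X) {d : ℕ}
    (hd : 2 * G.gapCost ≤ d) :
    TraceEnumerates (listCIBody pick depth A U X).trace
      {r | ∃ C ∈ G.AAC ord X, r = G.ciOf ord X C} ∧
    GapBound (listCIBody pick depth A U X).trace (2 * G.gapCost) (2 * G.gapCost) d ∧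
    (Silent (listCIBody pick depth A U X).trace →
      (listCIBody pick depth A U X).trace.length ≤ 2 * G.localCost) ∧
    (listCIBody pick depth A U X).val = Function.update U X true := by
  have hS := hord.isAncestral_upTo X
  have hXS : X ∈ upTo ord X := le_refl (ord.idxOf X)
  have hcard : 1 ≤ Fintype.card V := Fintype.card_pos_iff.2 ⟨X⟩
  have huniv : G.IsAncestral Set.univ := (Set.subset_univ _).antisymm (CausalGraph.subset_An _)
  have hval : (listCIBody pick depth A U X).val = Function.update U X true := rfl
  have hlead : (listCIBody pick depth A U X).Leads (100 * G.size) (fun t =>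
      TraceEnumerates t {r | ∃ C ∈ G.AAC ord X, r = G.ciOf ord X C} ∧
      GapBound t G.gapCost G.gapCost d ∧ (Silent t → t.length ≤ G.localCost)) := by
    refine Leads.le ((spec_setBit U X).leads fun U' hU' => spec_newArray.leads fun a ha =>
      (spec_setBits a [X]).leads fun one hone => (hA.spec_anSet huniv (Set.subset_univ _)).leads
      fun N hN => (hA.spec_induce N).leads fun A₁ hA₁ => (hA₁.spec_cComp X).leads fun I hI =>
      (hA.spec_induce U').leads fun AX hAX => (hAX.spec_cComp X).leads (b := 0) fun R hR =>
      leads_trace ?_) ?_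
    · have hone' : {v | one v = true} = {X} := by
        ext v
        simp [hone, ha]
      have hNset : Set.univ ∩ {v | N v = true} = G.An {X} := by
        rw [Set.univ_inter, ← hone']; exact Set.ext hN
      have hUset : Set.univ ∩ {v | U' v = true} = upTo ord X := by
        rw [Set.univ_inter]
        ext v
        rw [Set.mem_ofPred_eq, hU', update_true_iff, hU]
      have hIset : {v | I v = true} = G.cComponent (G.An {X}) X := by
        rw [← hNset]; exact Set.ext hI
      have hRset : {v | R v = true} = G.cComponent (upTo ord X) X := by
        rw [← hUset]; exact Set.ext hR
      rw [hUset] at hAX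
      have hAnS : G.An {X} ⊆ upTo ord X := hS.An_subset (by simpa using hXS)
      have hIac : G.IsAC (upTo ord X) X {v | I v = true} := by
        rw [hIset]
        exact CausalGraph.isAC_cComponent (CausalGraph.isAncestral_An _) hAnS
          (CausalGraph.subset_An _ rfl)
      have hRac : G.IsAC (upTo ord X) X {v | R v = true} := by
        rw [hRset]
        exact CausalGraph.isAC_cComponent hS subset_rfl hXS
      have hIR : {v | I v = true} ⊆ {v | R v = true} := by
        rw [hIset, hRset]
        exact CausalGraph.cComponent_mono hAnS X
      -- `X` lies in `I`, so `R \ I` has at most `n - 1` elements, and a cap of `n` on the depth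
      -- suffices.
      have hncard : ({v | R v = true} \ {v | I v = true}).ncard ≤ Fintype.card V - 1 := by
        rw [← Nat.card_eq_fintype_card, ← Set.ncard_univ,
          ← Set.ncard_sdiff_singleton_of_mem (Set.mem_univ X)]
        refine Set.ncard_le_ncard fun v hv => ⟨trivial, ?_⟩
        rintro rfl
        exact hv.2 hIac.self_mem
      have hgap : (2 * (Fintype.card V - 1) + 1) * (G.localCost + 1) ≤ G.gapCost :=
        Nat.mul_le_mul_right _ (by omega)
      obtain ⟨h1, h2, h3⟩ := hAX.trace_listCIX hS (hord.not_dir X) pick hpick d depth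
        (Fintype.card V - 1) (by omega) (by omega) I R hIac hRac hIR hncard
      have hset : G.relsBetween (upTo ord X) X {v | I v = true} {v | R v = true} =
          {r | ∃ C ∈ G.AAC ord X, r = G.ciOf ord X C} := by
        ext r
        constructor
        · rintro ⟨C, hC, hadm, _, _, rfl⟩
          exact ⟨C, CausalGraph.mem_AAC_iff.2 ⟨hC, hadm⟩, rfl⟩
        · rintro ⟨C, hC, rfl⟩
          -- Every AC is in the initial interval, because its ancestral set satisfies `An({X}) ⊆ T ⊆
          -- V^{≤X}`.
          obtain ⟨⟨T, hT, hTS, hXT, rfl⟩, hadm⟩ := CausalGraph.mem_AAC_iff.1 hC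
          refine ⟨_, CausalGraph.isAC_cComponent hT hTS hXT, hadm, ?_, ?_, rfl⟩
          · rw [hIset]
            exact CausalGraph.cComponent_mono (hT.An_subset (by simpa using hXT)) X
          · rw [hRset]
            exact CausalGraph.cComponent_mono hTS X
      rw [← hset]
      have htr : ∀ c : Prog V Unit, (c >>= fun _ => (pure U' : Prog V _)).trace = c.trace :=
        fun c => List.append_nil _
      rw [htr]
      exact ⟨h1, h2.mono hgap hgap le_rfl, h3⟩
    · simp only [List.length_cons, List.length_nil]
      unfold CausalGraph.size
      omega
  obtain ⟨t, u, htrace, ht, htk, h1, h2, h3⟩ := hlead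
  -- The preparation for one variable costs at most one `localCost`, so a variable without output
  -- costs at most two.
  have hlocal : 100 * G.size ≤ G.localCost := by
    unfold CausalGraph.localCost
    have := Nat.mul_le_mul_right (400 * G.size) hcard
    omega
  have hgap : G.localCost + 1 ≤ G.gapCost := Nat.le_mul_of_pos_left _ (by omega)
  rw [htrace]
  refine ⟨?_, ?_, fun h => ?_, hval⟩
  · have := (traceEnumerates_of_silent ht).append h1 (Set.empty_disjoint _)
    rwa [Set.empty_union] at this
  · exact (gapBound_of_length_le (p := G.gapCost) (s := G.gapCost) (by omega) (by omega)
      (by omega)).append h2 (by omega) (fun _ => by omega) (by omega)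
      (fun h => by have := h3 h; omega) (by omega)
  · have := h3 (silent_append.1 h).2
    rw [List.length_append]
    omega

/-- A stretch without output may span many variables. Those without relations add only `2 *
localCost` each; the larger `gapCost` enters only through the variables at the two ends of the
stretch. -/
theorem trace_listCI_loop {ord : List V} (hord : G.IsConsistentOrder ord)
    (hA : A.Stores G Set.univ) (pick : V → (V → Bool) → (V → Bool) → List V → V)
    (hpick : ∀ X I R T, T ≠ [] → pick X I R T ∈ T) {depth : ℕ} (hdepth : Fintype.card V ≤ depth)
    {d : ℕ} (suf : List V) :
    ∀ (pre : List V) (U : V → Bool), ord = pre ++ suf → (∀ v, U v = true ↔ v ∈ pre) →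
      suf.length * (2 * G.localCost) + 4 * G.gapCost ≤ d →
      TraceEnumerates (suf.foldlM (listCIBody pick depth A) U).trace
        {r | ∃ X ∈ suf, ∃ C ∈ G.AAC ord X, r = G.ciOf ord X C} ∧
      GapBound (suf.foldlM (listCIBody pick depth A) U).trace
        (suf.length * (2 * G.localCost) + 2 * G.gapCost)
        (suf.length * (2 * G.localCost) + 2 * G.gapCost) d ∧
      (Silent (suf.foldlM (listCIBody pick depth A) U).trace →
        (suf.foldlM (listCIBody pick depth A) U).trace.length ≤
          suf.length * (2 * G.localCost)) := by
  induction suf with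
  | nil =>
    intro pre U _ _ _
    refine ⟨?_, gapBound_of_length_le (Nat.zero_le _) (Nat.zero_le _) (Nat.zero_le _),
      fun _ => Nat.zero_le _⟩
    simpa using! traceEnumerates_of_silent (V := V) (t := []) (by simp [Silent])
  | cons X suf ih =>
    intro pre U hpre hU hd
    rw [List.length_cons, Nat.succ_mul] at hd ⊢
    have hnodup := hord.1
    rw [hpre] at hnodup
    obtain ⟨h1, h2, h3, h4⟩ := trace_listCIBody hord hA pick hpick hdepth X U (d := d)
      (fun v => by rw [hU, hpre, mem_upTo_iff hnodup]) (by omega)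
    obtain ⟨g1, g2, g3⟩ := ih (pre ++ [X]) (Function.update U X true) (by simp [hpre])
      (fun v => by rw [update_true_iff, hU]; simp) (by omega)
    rw [List.foldlM_cons, trace_bind, h4]
    refine ⟨?_, ?_, fun h => ?_⟩
    · have hset : {r | ∃ Y ∈ X :: suf, ∃ C ∈ G.AAC ord Y, r = G.ciOf ord Y C} =
          {r | ∃ C ∈ G.AAC ord X, r = G.ciOf ord X C} ∪
            {r | ∃ Y ∈ suf, ∃ C ∈ G.AAC ord Y, r = G.ciOf ord Y C} := by
        ext r
        simp
      rw [hset]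
      refine h1.append g1 ?_
      rw [Set.disjoint_left]
      rintro r ⟨C, _, rfl⟩ ⟨Y, hY, C', _, h⟩
      -- Relations of different variables differ in their left-hand sides.
      obtain rfl : X = Y := congrArg CIRel.lhs h
      exact (List.nodup_cons.1 (List.Nodup.of_append_right hnodup)).1 hY
    · exact h2.append g2 (by omega) (fun h => by have := h3 h; omega) (by omega)
        (fun h => by have := g3 h; omega) (by omega)
    · have := h3 (silent_append.1 h).1
      have := g3 (silent_append.1 h).2
      rw [List.length_append]
      omega

end AdjLists

/-- `localCost` is of order `n` times `size`, one graph search bound per candidate; the second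
factor `n` is the number of variables or the recursion depth. For `n ≥ 1`, `size` is at most `2(n +
m)`. -/
theorem delay_bound_le {V : Type} [Fintype V] (G : CausalGraph V) (h : 1 ≤ Fintype.card V) :
    Fintype.card V * (2 * G.localCost) + 5 * G.gapCost ≤
      26000 * (Fintype.card V ^ 2 * (Fintype.card V + G.numEdges)) := by
  have hsize : G.size ≤ 2 * (Fintype.card V + G.numEdges) := by
    unfold CausalGraph.size; omega
  unfold CausalGraph.gapCost CausalGraph.localCost
  generalize Fintype.card V = n at *
  generalize n + G.numEdges = m at *
  generalize hs : G.size = s at *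
  have hs1 : 1 ≤ s := by rw [← hs]; unfold CausalGraph.size; omega
  have h1 : n * (400 * s) + 1 ≤ 401 * (n * s) := by nlinarith [Nat.mul_le_mul h hs1]
  have h2 : 2 * n + 1 ≤ 3 * n := by omega
  have h3 : (2 * n + 1) * (n * (400 * s) + 1) ≤ 3 * n * (401 * (n * s)) := Nat.mul_le_mul h2 h1
  have h4 : n ^ 2 * s ≤ n ^ 2 * (2 * m) := Nat.mul_le_mul_left _ hsize
  -- With `s` the size, the total is at most `(800 + 5 · 3 · 401) n² s = 6815 n² s`, hence at most
  -- `13630 n² (n + m)`, within the chosen constant.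
  nlinarith

theorem mainTheorem5 :
    ∃ c : ℕ, ∀ (V : Type) [Fintype V] [DecidableEq V] (G : CausalGraph V) (ord : List V)
      (A : AdjLists V) (pick : V → (V → Bool) → (V → Bool) → List V → V) (depth : ℕ),
      G.IsConsistentOrder ord → A.Stores G Set.univ →
      (∀ X I R T, T ≠ [] → pick X I R T ∈ T) → Fintype.card V ≤ depth →
      -- ListCI is correct
      EnumeratesExactly (A.listCI pick depth ord) (G.nonvacuousCIs ord)
        (c * ((Fintype.card V) ^ 2 * (Fintype.card V + G.numEdges))) ∧
      -- its subroutines FindAAC and ListCIX are correct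
      ∀ (X : V) (AX : AdjLists V) (I R : V → Bool), AX.Stores G (upTo ord X) →
        {v | I v = true} ∈ G.AC ord X → {v | R v = true} ∈ G.AC ord X →
        {v | I v = true} ⊆ {v | R v = true} →
        ((∀ C, (AX.findAAC X I R).val = some C →
            {v | C v = true} ∈ G.AAC ord X ∧
            {v | I v = true} ⊆ {v | C v = true} ∧ {v | C v = true} ⊆ {v | R v = true}) ∧
          ((AX.findAAC X I R).val = none →
            ¬ ∃ C ∈ G.AAC ord X, {v | I v = true} ⊆ C ∧ C ⊆ {v | R v = true})) ∧
        EnumeratesExactly (AX.listCIX pick X depth I R)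
          {r | ∃ C ∈ G.AAC ord X, {v | I v = true} ⊆ C ∧ C ⊆ {v | R v = true} ∧
            r = G.ciOf ord X C}
          (c * ((Fintype.card V) ^ 2 * (Fintype.card V + G.numEdges))) := by
  refine ⟨26000, fun V _ _ G ord A pick depth hord hA hpick hdepth => ⟨?_, ?_⟩⟩
  · have hset : G.nonvacuousCIs ord =
        {r | ∃ X ∈ ord, ∃ C ∈ G.AAC ord X, r = G.ciOf ord X C} := by
      ext r
      constructor
      · rintro ⟨⟨X, C, hC, rfl⟩, hne⟩
        exact ⟨X, hord.2.1 X, C, ⟨hC, hne⟩, rfl⟩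
      · rintro ⟨X, _, C, ⟨hC, hne⟩, rfl⟩
        exact ⟨⟨X, C, hC, rfl⟩, hne⟩
    have htrace : (A.listCI pick depth ord).trace =
        List.replicate (Fintype.card V) TraceEvent.step ++
          (ord.foldlM (AdjLists.listCIBody pick depth A) fun _ => false).trace := by
      change (List.replicate (Fintype.card V) TraceEvent.step ++ []) ++ (_ ++ []) = _
      rw [List.append_nil, List.append_nil]
      rfl
    have hlen : ord.length ≤ Fintype.card V := hord.1.length_le_card
    have hmul := Nat.mul_le_mul_right (2 * G.localCost) hlen
    have hgap : Fintype.card V ≤ G.gapCost := by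
      have := Nat.mul_le_mul_left (2 * Fintype.card V + 1) (show 1 ≤ G.localCost + 1 by omega)
      unfold CausalGraph.gapCost
      omega
    obtain ⟨h1, h2, h3⟩ := AdjLists.trace_listCI_loop hord hA pick hpick hdepth
      (d := Fintype.card V * (2 * G.localCost) + 5 * G.gapCost) ord [] (fun _ => false) rfl
      (by simp) (by omega)
    have hsil : Silent (List.replicate (Fintype.card V)
        (TraceEvent.step : TraceEvent (CIOutput V))) := fun e he => List.eq_of_mem_replicate he
    have hreplen : (List.replicate (Fintype.card V)
        (TraceEvent.step : TraceEvent (CIOutput V))).length = Fintype.card V :=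
      List.length_replicate
    -- For the empty graph the claimed delay is zero, so the trace must be shown to be empty; the
    -- numerical bound applies only for `n ≥ 1`.
    rcases Nat.eq_zero_or_pos (Fintype.card V) with h0 | hpos
    · obtain rfl : ord = [] := List.length_eq_zero_iff.1 (by omega)
      rw [h0] at htrace
      refine enumeratesExactly_of_trace (p := 0) (s := 0) ?_ ?_
      · rw [htrace, hset]
        exact h1
      · rw [htrace]
        exact gapBound_of_length_le (Nat.zero_le _) (Nat.zero_le _) (Nat.zero_le _)
    · have hgaps : GapBound (A.listCI pick depth ord).trace
          (Fintype.card V * (2 * G.localCost) + 5 * G.gapCost)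
          (Fintype.card V * (2 * G.localCost) + 5 * G.gapCost)
          (Fintype.card V * (2 * G.localCost) + 5 * G.gapCost) := by
        rw [htrace]
        exact (gapBound_of_length_le (p := Fintype.card V) (s := Fintype.card V) hreplen.le
          hreplen.le (by omega)).append h2 (by omega) (fun _ => by omega) (by omega)
          (fun h => by have := h3 h; omega) (by omega)
      refine enumeratesExactly_of_trace ?_ (hgaps.mono le_rfl le_rfl (delay_bound_le G hpos))
      rw [htrace, hset]
      have := (traceEnumerates_of_silent hsil).append h1 (Set.empty_disjoint _)
      rwa [Set.empty_union] at this
  · intro X AX I R hAX hI hR hIR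
    have hS := hord.isAncestral_upTo X
    have hsink := hord.not_dir X
    have hpos : 1 ≤ Fintype.card V := Fintype.card_pos_iff.2 ⟨X⟩
    rw [CausalGraph.mem_AC_iff] at hI hR
    refine ⟨⟨fun C hC => ?_, fun hnone => ?_⟩, ?_⟩
    · obtain ⟨h1, h2, h3⟩ := (hAX.spec_findAAC hS hsink hI hR hIR).val.1 C hC
      exact ⟨CausalGraph.mem_AAC_iff.2 ⟨h1, h2⟩, h3⟩
    · rintro ⟨C, hC, h3⟩
      obtain ⟨h1, h2⟩ := CausalGraph.mem_AAC_iff.1 hC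
      exact (hAX.spec_findAAC hS hsink hI hR hIR).val.2 hnone ⟨C, h1, h2, h3⟩
    · have hncard : ({v | R v = true} \ {v | I v = true}).ncard ≤ Fintype.card V - 1 := by
        rw [← Nat.card_eq_fintype_card, ← Set.ncard_univ,
          ← Set.ncard_sdiff_singleton_of_mem (Set.mem_univ X)]
        refine Set.ncard_le_ncard fun v hv => ⟨trivial, ?_⟩
        rintro rfl
        exact hv.2 hI.self_mem
      have hgap : (2 * (Fintype.card V - 1) + 1) * (G.localCost + 1) ≤ G.gapCost :=
        Nat.mul_le_mul_right _ (by omega)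
      have hbound := delay_bound_le G hpos
      obtain ⟨h1, h2, _⟩ := hAX.trace_listCIX hS hsink pick hpick
        (26000 * (Fintype.card V ^ 2 * (Fintype.card V + G.numEdges))) depth
        (Fintype.card V - 1) (by omega) (by omega) I R hI hR hIR hncard
      refine enumeratesExactly_of_trace ?_ h2
      convert h1 using 1
      ext r
      constructor
      · rintro ⟨C, hC, h3, h4, rfl⟩
        obtain ⟨h5, h6⟩ := CausalGraph.mem_AAC_iff.1 hC
        exact ⟨C, h5, h6, h3, h4, rfl⟩
      · rintro ⟨C, h5, h6, h3, h4, rfl⟩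
        exact ⟨C, CausalGraph.mem_AAC_iff.2 ⟨h5, h6⟩, h3, h4, rfl⟩
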